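/- **Slices.** Let $\Gamma_1,\Gamma_2$ be finite sets of labels. A *unit slice* of arity $r$ is a finite digraph $\mathbf S$ whose vertices are at most one center vertex (labeled in $\Gamma_1$) and frontier vertices $[j,i]$ with $0\le j\le r$, $i\ge 1$ (those with first coordinate $j$ form the frontier $F_j$); its edges are labeled in $\Gamma_2$, no edge has both endpoints in the same frontier, every frontier vertex is an endpoint of exactly one edge, and two different loops at the center have different labels. Its *width* is $\max_j|F_j|$ and its *extra-width* is the largest $i$ of a frontier vertex $[j,i]$. For $c\le q$, $\Sigma(c,q,\Gamma_1,\Gamma_2)$ is the set of unit slices of arity at most $2$, width at most $c$ and extra-width at most $q$, and $\Sigma(q,\Gamma_1,\Gamma_2)\subseteq\Sigma(q,q,\Gamma_1,\Gamma_2)$ is the subset of slices in which each $F_j$ is $\{[j,1],\dots,[j,c_j]\}$ for some $c_j$. A slice $\mathbf S$ *can be glued to* $\mathbf S'$ *at frontier* $j\ge1$ if $[0,i]$ is a vertex of $\mathbf S$ iff $[j,i]$ is a vertex of $\mathbf S'$, and in this case the edges of $\mathbf S$ and $\mathbf S'$ at these vertices have the same label, and one of them ends where the other one starts. **Unit decompositions.**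 A slice of arity $r$ is regarded as an $r$-ary function symbol. A term $\mathbf T$ with set of positions $\mathrm{Pos}(\mathbf T)\subseteq\{1,2\}^*$ and symbol $\mathbf T[p]$ at position $p$ is a *unit decomposition* if $\mathbf T[pj]$ can be glued to $\mathbf T[p]$ at frontier $j$ for all $p,pj\in\mathrm{Pos}(\mathbf T)$ and the out-frontier $F_0$ of the slice at the root is empty; $|\mathbf T|=|\mathrm{Pos}(\mathbf T)|$. It represents a labeled digraph $\overset{\circ}{\mathbf T}$, which has a vertex $v_p$ for each $p$ such that $\mathbf T[p]$ has a center vertex, and an edge for each maximal sequence of edges, in slices at successive neighboring positions, that starts and ends in center vertices and passes from $[0,i]$ at position $pj$ to $[j,i]$ at position $p$ or vice versa; labels are inherited. The *tree-zig-zag number* of $\mathbf T$ is the maximum, over all directed simple paths $\mathfrak p$ of $\overset{\circ}{\mathbf T}$ and all $p\in\mathrm{Pos}(\mathbf T)$, of the number of edges of $\mathfrak p$ with exactly one endpoint in $\{v_{pu}\}_{u}$. **Automata.** A bottom-up tree-automaton $\mathcal A$ has size $|\mathcal A|$, the number of its states plus the number of its transitions. It is a *slice tree-automaton* over $\Sigma$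 if it is an automaton over the ranked alphabet $\Sigma$ and accepts only unit decompositions. $\mathcal L(\mathcal A)$ is the set of accepted terms and $\mathcal L_{\mathcal G}(\mathcal A)$ is the class of digraphs isomorphic to $\overset{\circ}{\mathbf T}$ for some $\mathbf T\in\mathcal L(\mathcal A)$. It is *$z$-saturated* if for every $H\in\mathcal L_{\mathcal G}(\mathcal A)$, every unit decomposition $\mathbf T$ over $\Sigma$ with $\overset{\circ}{\mathbf T}\simeq H$ and tree-zig-zag number at most $z$ belongs to $\mathcal L(\mathcal A)$. **Theorem (Slice Theoretic Metatheorem).** There is an algorithm with the following property. Let $k,z,q\in\mathbb N$ with $k\cdot z\le q$, let $\mathbf T$ be a unit decomposition over $\Sigma(q,\Gamma_1,\Gamma_2)$ of tree-zig-zag number at most $z$, and let $\mathcal A$ be a deterministic $z$-saturated slice tree-automaton over $\Sigma(k\cdot z,q,\Gamma_1,\Gamma_2)$ such that each digraph in $\mathcal L_{\mathcal G}(\mathcal A)$ is the union of $k$ (not necessarily disjoint) directed simple paths. Given $\mathbf T$ and $\mathcal A$, the algorithm computes, in binary, the number of subgraphs of $\overset{\circ}{\mathbf T}$ that are isomorphic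 to a digraph in $\mathcal L_{\mathcal G}(\mathcal A)$, in time $|\mathbf T|^{O(1)}\cdot q^{O(k\cdot z)}\cdot|\mathcal A|^{O(1)}$; more precisely, in at most $C\cdot|\mathbf T|^{C}\cdot q^{C\cdot k\cdot z}\cdot(|\mathcal A|+1)^{C}$ steps for an absolute constant $C$ (with $0^0=1$). Here a step is a unit operation on lists (pairing, projection, comparison of two atoms, branching, recursive call), and labels, indices and states are atoms of the input. -/

import Mathlib

namespace SliceCount

/-! ### Labeled digraphs (multi-edges and loops allowed), paths, isomorphism, subgraphs -/

/-- A digraph with vertices and edges labeled by natural numbers. -/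
structure LabeledDigraph where
  V : Type
  E : Type
  src : E → V
  tgt : E → V
  vertexLabel : V → ℕ
  edgeLabel : E → ℕ

namespace LabeledDigraph

/-- The edges from `v` to `w` with label `b`. -/
def edgesBetween (G : LabeledDigraph) (v w : G.V) (b : ℕ) : Set G.E :=
  {e | G.src e = v ∧ G.tgt e = w ∧ G.edgeLabel e = b}

/-- Isomorphisms: label preserving bijections of the vertices that preserve, for each ordered pair
of vertices and each label, the number of edges. -/
structure Iso (G H : LabeledDigraph) where
  toEquiv : G.V ≃ H.V
  vertexLabel_eq : ∀ v, G.vertexLabel v = H.vertexLabel (toEquiv v)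
  edges_eq : ∀ v w b,
    (G.edgesBetween v w b).encard = (H.edgesBetween (toEquiv v) (toEquiv w) b).encard

/-- A directed simple path `v₁ e₁ v₂ … eₙ₋₁ vₙ`, `n ≥ 1`, with pairwise distinct vertices. -/
structure SimplePath (G : LabeledDigraph) where
  verts : List G.V
  edges : List G.E
  length_eq : verts.length = edges.length + 1
  nodup : verts.Nodup
  src_eq : ∀ (i : ℕ) (h : i < edges.length), G.src edges[i] = verts[i]
  tgt_eq : ∀ (i : ℕ) (h : i < edges.length), G.tgt edges[i] = verts[i + 1]

/-- `G` is the union of `k` (not necessarily disjoint) directed simple paths. -/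
def IsUnionOfPaths (G : LabeledDigraph) (k : ℕ) : Prop :=
  ∃ P : Fin k → G.SimplePath,
    (∀ v, ∃ i, v ∈ (P i).verts) ∧ (∀ e, ∃ i, e ∈ (P i).edges)

/-- A subgraph: a set of vertices and a set of edges whose endpoints are among the vertices. -/
structure Sub (G : LabeledDigraph) where
  verts : Set G.V
  edges : Set G.E
  src_mem : ∀ e ∈ edges, G.src e ∈ verts
  tgt_mem : ∀ e ∈ edges, G.tgt e ∈ verts

/-- A subgraph as a digraph in its own right, with the inherited labels. -/
def Sub.toDigraph {G : LabeledDigraph} (H : G.Sub) : LabeledDigraph where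
  V := H.verts
  E := H.edges
  src e := ⟨G.src e.1, H.src_mem e.1 e.2⟩
  tgt e := ⟨G.tgt e.1, H.tgt_mem e.1 e.2⟩
  vertexLabel v := G.vertexLabel v.1
  edgeLabel e := G.edgeLabel e.1

/-- The edges with one endpoint in `X` and the other one outside `X`. -/
def cut (G : LabeledDigraph) (X : Set G.V) : Set G.E :=
  {e | (G.src e ∈ X ∧ G.tgt e ∉ X) ∨ (G.src e ∉ X ∧ G.tgt e ∈ X)}

end LabeledDigraph

/-! ### Olive-tree decompositions and the tree-zig-zag number -/

/-- An olive-tree decomposition: a binary tree, given as a finite prefix closed and well numbered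
set of strings over `{1, 2}` containing the empty string, and an injective map from the vertices
to the nodes. -/
structure OliveTree (G : LabeledDigraph) where
  nodes : Finset (List ℕ)
  root_mem : [] ∈ nodes
  digits : ∀ p ∈ nodes, ∀ j ∈ p, j = 1 ∨ j = 2
  prefix_closed : ∀ p j, p ++ [j] ∈ nodes → p ∈ nodes
  well_numbered : ∀ p, p ++ [2] ∈ nodes → p ++ [1] ∈ nodes
  map : G.V → List ℕ
  map_mem : ∀ v, map v ∈ nodes
  map_injective : Function.Injective map

namespace OliveTree

variable {G : LabeledDigraph}

/-- The vertices that are mapped to a descendant of the node `p` (`p` itself included). -/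
def below (D : OliveTree G) (p : List ℕ) : Set G.V :=
  {v | p <+: D.map v}

/-- The largest number of edges of a simple path that cross the cut of a node. -/
noncomputable def tzn (D : OliveTree G) : ℕ∞ :=
  ⨆ (P : G.SimplePath) (p : List ℕ) (_ : p ∈ D.nodes),
    ({e | e ∈ P.edges} ∩ G.cut (D.below p)).encard

end OliveTree

/-! ### Unit slices -/

/-- Vertices of a unit slice: the center vertex, and the frontier vertices `[j, i]`. -/
inductive SliceVertex where
  | center : SliceVertex
  | frontier (j i : ℕ) : SliceVertex
deriving DecidableEq

/-- The indices `i` such that the vertex is `[j, i]`. -/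
def SliceVertex.indices (j : ℕ) : SliceVertex → Finset ℕ
  | .center => ∅
  | .frontier j' i => if j' = j then {i} else ∅

structure SliceEdge where
  src : SliceVertex
  tgt : SliceVertex
  label : ℕ
deriving DecidableEq

/-- `v` is an endpoint of `e`. -/
def SliceEdge.Incident (e : SliceEdge) (v : SliceVertex) : Prop :=
  e.src = v ∨ e.tgt = v

/-- Unit slices. `center` is the label of the center vertex, if there is one. Each frontier vertex
is an endpoint of exactly one edge, so the frontiers are read off from the edges, and an edge with
an endpoint in a frontier is determined by its endpoints. -/
structure Slice where
  arity : ℕ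
  center : Option ℕ
  edges : Finset SliceEdge
  center_of_incident : ∀ e ∈ edges, e.Incident .center → center.isSome
  frontier_of_incident : ∀ e ∈ edges, ∀ j i, e.Incident (.frontier j i) → j ≤ arity ∧ 1 ≤ i
  not_same_frontier : ∀ e ∈ edges, ∀ j i i', ¬ (e.src = .frontier j i ∧ e.tgt = .frontier j i')
  unique_edge : ∀ e ∈ edges, ∀ e' ∈ edges, ∀ j i,
    e.Incident (.frontier j i) → e'.Incident (.frontier j i) → e = e'

namespace Slice

/-- The set of all `i` such that `[j, i]` belongs to the `j`-th frontier. -/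
def frontier (S : Slice) (j : ℕ) : Finset ℕ :=
  S.edges.biUnion fun e => e.src.indices j ∪ e.tgt.indices j

def Normalized (S : Slice) : Prop :=
  ∀ j, S.frontier j = Finset.Icc 1 (S.frontier j).card

/-- `S` can be glued to `S'` at frontier `j`. -/
def GluableTo (S S' : Slice) (j : ℕ) : Prop :=
  (1 ≤ j ∧ j ≤ S'.arity) ∧
  (∀ i, i ∈ S.frontier 0 ↔ i ∈ S'.frontier j) ∧
  ∀ i, ∀ e ∈ S.edges, ∀ e' ∈ S'.edges,
    e.Incident (.frontier 0 i) → e'.Incident (.frontier j i) →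
      e.label = e'.label ∧
      ((e.tgt = .frontier 0 i ∧ e'.src = .frontier j i) ∨
        (e.src = .frontier 0 i ∧ e'.tgt = .frontier j i))

end Slice

/-- The unit slices of arity at most two, width at most `c` and extra-width at most `q`, with
vertex label in `Γ₁` and edge labels in `Γ₂`. -/
def sliceAlphabet (c q : ℕ) (Γ₁ Γ₂ : Finset ℕ) : Set Slice :=
  {S | S.arity ≤ 2 ∧ (∀ j, (S.frontier j).card ≤ c) ∧ (∀ j, ∀ i ∈ S.frontier j, i ≤ q) ∧
    (∀ a ∈ S.center, a ∈ Γ₁) ∧ ∀ e ∈ S.edges, e.label ∈ Γ₂}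

/-- The normalized slices of width at most `q`. -/
def normalizedAlphabet (q : ℕ) (Γ₁ Γ₂ : Finset ℕ) : Set Slice :=
  {S | S ∈ sliceAlphabet q q Γ₁ Γ₂ ∧ S.Normalized}

/-! ### Terms over slices and unit decompositions -/

/-- Trees of slices with at most two children; `SliceTerm.Over` below requires the number of
children to be the arity. -/
inductive SliceTerm where
  | nullary (S : Slice) : SliceTerm
  | unary (S : Slice) (t : SliceTerm) : SliceTerm
  | binary (S : Slice) (t₁ t₂ : SliceTerm) : SliceTerm

namespace SliceTerm

def root : SliceTerm → Slice
  | nullary S => S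
  | unary S _ => S
  | binary S _ _ => S

/-- Terms over the ranked alphabet `A`. -/
def Over (A : Set Slice) : SliceTerm → Prop
  | nullary S => S ∈ A ∧ S.arity = 0
  | unary S t => S ∈ A ∧ S.arity = 1 ∧ t.Over A
  | binary S t₁ t₂ => S ∈ A ∧ S.arity = 2 ∧ t₁.Over A ∧ t₂.Over A

/-- The set of positions of a term. -/
def pos : SliceTerm → Finset (List ℕ)
  | nullary _ => {[]}
  | unary _ t => {[]} ∪ t.pos.image (List.cons 1)
  | binary _ t₁ t₂ => {[]} ∪ t₁.pos.image (List.cons 1) ∪ t₂.pos.image (List.cons 2)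

/-- The size of a term, the number of its positions. -/
def size (t : SliceTerm) : ℕ := t.pos.card

/-- The slice at a position, `none` if there is no such position. -/
def get? : SliceTerm → List ℕ → Option Slice
  | t, [] => some t.root
  | unary _ t, 1 :: p => t.get? p
  | binary _ t₁ _, 1 :: p => t₁.get? p
  | binary _ _ t₂, 2 :: p => t₂.get? p
  | _, _ :: _ => none

/-- Unit decompositions: neighboring slices can be glued, and the out-frontier at the root is
empty. -/
def IsUnitDecomposition (t : SliceTerm) : Prop :=
  (∀ p j S S', t.get? p = some S → t.get? (p ++ [j]) = some S' → S'.GluableTo S j) ∧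
    t.root.frontier 0 = ∅

/-! The digraph represented by a unit decomposition -/

/-- The label of the center vertex of the slice at position `p`, if there is one. -/
def centerAt (t : SliceTerm) (p : List ℕ) : Option ℕ := (t.get? p).bind Slice.center

/-- One element of a sliced edge sequence: a position and an edge of the slice there. -/
structure Piece where
  position : List ℕ
  edge : SliceEdge

/-- `y` may follow `x` in a sliced edge sequence: their positions are neighbors, and the target of
`x` is the frontier vertex matched with the source of `y`. -/
def Piece.Next (x y : Piece) : Prop :=
  ∃ j i, (x.position = y.position ++ [j] ∧
        x.edge.tgt = .frontier 0 i ∧ y.edge.src = .frontier j i) ∨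
    (y.position = x.position ++ [j] ∧
        x.edge.tgt = .frontier j i ∧ y.edge.src = .frontier 0 i)

/-- Sliced edge sequences of `t`. -/
structure EdgeSequence (t : SliceTerm) where
  pieces : List Piece
  ne_nil : pieces ≠ []
  edge_mem : ∀ x ∈ pieces, ∃ S, t.get? x.position = some S ∧ x.edge ∈ S.edges
  src_center : (pieces.head ne_nil).edge.src = .center
  tgt_center : (pieces.getLast ne_nil).edge.tgt = .center
  chain : pieces.IsChain Piece.Next

theorem centerAt_isSome_of_incident {t : SliceTerm} {x : Piece}
    (h : ∃ S, t.get? x.position = some S ∧ x.edge ∈ S.edges) (hx : x.edge.Incident .center) :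
    (t.centerAt x.position).isSome := by
  obtain ⟨S, hS, he⟩ := h
  simpa [centerAt, hS] using S.center_of_incident _ he hx

/-- The digraph of `t`: one vertex for each position whose slice has a center vertex, one edge for
each sliced edge sequence. -/
def toDigraph (t : SliceTerm) : LabeledDigraph where
  V := {p : List ℕ // (t.centerAt p).isSome}
  E := t.EdgeSequence
  src K := ⟨(K.pieces.head K.ne_nil).position,
    centerAt_isSome_of_incident (K.edge_mem _ (List.head_mem _)) (Or.inl K.src_center)⟩
  tgt K := ⟨(K.pieces.getLast K.ne_nil).position,
    centerAt_isSome_of_incident (K.edge_mem _ (List.getLast_mem _)) (Or.inr K.tgt_center)⟩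
  vertexLabel v := (t.centerAt v.1).get v.2
  edgeLabel K := (K.pieces.head K.ne_nil).edge.label

/-- `t` is compatible with the olive-tree decomposition `D` of `G`: same tree, and sending a vertex
`u` of `G` to the center vertex at position `D.map u` is an isomorphism. -/
def Compatible (t : SliceTerm) {G : LabeledDigraph} (D : OliveTree G) : Prop :=
  D.nodes = t.pos ∧ ∃ φ : G.Iso t.toDigraph, ∀ u, (φ.toEquiv u).1 = D.map u

/-- The tree-zig-zag number of `t` is at most `z`. -/
def TreeZigZagLE (t : SliceTerm) (z : ℕ) : Prop :=
  ∃ (G : LabeledDigraph) (D : OliveTree G), t.Compatible D ∧ D.tzn ≤ z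

end SliceTerm

/-! ### Tree slice languages -/

/-- The graph language of a set of unit decompositions, as a class of digraphs closed under
isomorphism. -/
def graphLanguage (L : Set SliceTerm) : Set LabeledDigraph :=
  {H | ∃ t ∈ L, Nonempty (H.Iso t.toDigraph)}

/-- `L` is `z`-saturated with respect to the slice alphabet `A`. -/
def Saturated (A : Set Slice) (L : Set SliceTerm) (z : ℕ) : Prop :=
  ∀ H ∈ graphLanguage L, ∀ t : SliceTerm, t.Over A → t.IsUnitDecomposition →
    Nonempty (t.toDigraph.Iso H) → t.TreeZigZagLE z → t ∈ L

/-! ### Bottom-up tree-automata -/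

/-- A bottom-up tree-automaton with states `0, …, numStates - 1`. A transition `(qs, S, r)` leads
from the states `qs` of the children and the symbol `S` to the state `r`. -/
structure TreeAutomaton where
  numStates : ℕ
  final : Finset (Fin numStates)
  trans : Finset (List (Fin numStates) × Slice × Fin numStates)

namespace TreeAutomaton

/-- `M` is an automaton over the ranked alphabet `A`. -/
def Over (A : Set Slice) (M : TreeAutomaton) : Prop :=
  ∀ d ∈ M.trans, d.2.1 ∈ A ∧ d.1.length = d.2.1.arity

def size (M : TreeAutomaton) : ℕ := M.numStates + M.trans.card

def Reaches (M : TreeAutomaton) : SliceTerm → Fin M.numStates → Prop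
  | .nullary S, r => ([], S, r) ∈ M.trans
  | .unary S t, r => ∃ r₁, M.Reaches t r₁ ∧ ([r₁], S, r) ∈ M.trans
  | .binary S t₁ t₂, r => ∃ r₁ r₂, M.Reaches t₁ r₁ ∧ M.Reaches t₂ r₂ ∧ ([r₁, r₂], S, r) ∈ M.trans

def language (M : TreeAutomaton) : Set SliceTerm :=
  {t | ∃ r ∈ M.final, M.Reaches t r}

def Deterministic (M : TreeAutomaton) : Prop :=
  ∀ qs S r r', (qs, S, r) ∈ M.trans → (qs, S, r') ∈ M.trans → r = r'

/-- `M` is a slice tree-automaton over `A`: it accepts only unit decompositions. -/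
def IsSliceAutomaton (A : Set Slice) (M : TreeAutomaton) : Prop :=
  M.Over A ∧ ∀ t ∈ M.language, t.IsUnitDecomposition

end TreeAutomaton

/-! ### The computation model

A first-order functional language over S-expressions. Programs may take S-expressions apart, pair
them up, compare atoms, branch, and call themselves recursively; every such operation costs one
step. There is no arithmetic on atoms, so a number that is computed is a list of bits. -/

/-- S-expressions: atoms and ordered pairs. -/
inductive SExpr where
  | atom (n : ℕ) : SExpr
  | cons (a b : SExpr) : SExpr
deriving DecidableEq

namespace SExpr

def fst : SExpr → SExpr
  | atom _ => atom 0
  | cons a _ => a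

def snd : SExpr → SExpr
  | atom _ => atom 0
  | cons _ b => b

/-- `1` on atoms and `0` on pairs. -/
def isAtom : SExpr → SExpr
  | atom _ => atom 1
  | cons _ _ => atom 0

/-- `1` on a pair of two equal atoms, `0` on everything else. -/
def eqAtom : SExpr → SExpr
  | cons (atom m) (atom n) => if m = n then atom 1 else atom 0
  | _ => atom 0

/-- Lists; the empty list is the atom `0`. -/
def ofList : List SExpr → SExpr
  | [] => atom 0
  | a :: l => cons a (ofList l)

/-- The list of the binary digits of a natural number, least significant digit first. -/
def ofNat (n : ℕ) : SExpr := ofList (n.bits.map fun b => atom b.toNat)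

end SExpr

/-- Programs, each of which computes a partial function on S-expressions. `call` is a recursive
call of the smallest enclosing `fix`, or of the whole program if there is none. -/
inductive Prog where
  | id : Prog
  | const (d : SExpr) : Prog
  | fst : Prog
  | snd : Prog
  | isAtom : Prog
  | eqAtom : Prog
  | pair (f g : Prog) : Prog
  | comp (g f : Prog) : Prog
  | ite (c f g : Prog) : Prog
  | fix (f : Prog) : Prog
  | call : Prog

/-- `Prog.Eval b p x y n`: with `b` as the body of recursive calls, the program `p` returns `y` on
input `x` after exactly `n` steps. -/
inductive Prog.Eval : Prog → Prog → SExpr → SExpr → ℕ → Prop where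
  | id (b : Prog) (x : SExpr) : Eval b .id x x 1
  | const (b : Prog) (d x : SExpr) : Eval b (.const d) x d 1
  | fst (b : Prog) (x : SExpr) : Eval b .fst x x.fst 1
  | snd (b : Prog) (x : SExpr) : Eval b .snd x x.snd 1
  | isAtom (b : Prog) (x : SExpr) : Eval b .isAtom x x.isAtom 1
  | eqAtom (b : Prog) (x : SExpr) : Eval b .eqAtom x x.eqAtom 1
  | pair {b f g : Prog} {x y z : SExpr} {m n : ℕ} :
      Eval b f x y m → Eval b g x z n → Eval b (.pair f g) x (.cons y z) (m + n + 1)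
  | comp {b f g : Prog} {x y z : SExpr} {m n : ℕ} :
      Eval b f x y m → Eval b g y z n → Eval b (.comp g f) x z (m + n + 1)
  | ite_true {b c f g : Prog} {x v y : SExpr} {m n : ℕ} :
      Eval b c x v m → v ≠ .atom 0 → Eval b f x y n → Eval b (.ite c f g) x y (m + n + 1)
  | ite_false {b c f g : Prog} {x y : SExpr} {m n : ℕ} :
      Eval b c x (.atom 0) m → Eval b g x y n → Eval b (.ite c f g) x y (m + n + 1)
  | fix {b f : Prog} {x y : SExpr} {n : ℕ} : Eval f f x y n → Eval b (.fix f) x y (n + 1)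
  | call {b : Prog} {x y : SExpr} {n : ℕ} : Eval b b x y n → Eval b .call x y (n + 1)

/-- On input `x`, the program `p` halts with output `y` after at most `N` steps. -/
def Prog.OutputsWithin (p : Prog) (x y : SExpr) (N : ℕ) : Prop :=
  ∃ n ≤ N, Prog.Eval p p x y n

/-! ### Inputs

Finite sets are presented to a program as lists without repetitions, in any order. -/

/-- The list `l` enumerates the finite set `s`. -/
def Enumerates {α : Type} (l : List α) (s : Finset α) : Prop :=
  l.Nodup ∧ ∀ a, a ∈ l ↔ a ∈ s

def SliceVertex.code : SliceVertex → SExpr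
  | .center => .atom 0
  | .frontier j i => .cons (.atom j) (.atom i)

def SliceEdge.code (e : SliceEdge) : SExpr :=
  .cons e.src.code (.cons e.tgt.code (.atom e.label))

def centerCode : Option ℕ → SExpr
  | none => .atom 0
  | some a => .cons (.atom a) (.atom 0)

/-- `d` presents the slice `S`: its arity, its center, the list of the edges that are not loops,
and the list of the loops at the center vertex. -/
def Slice.Presents (d : SExpr) (S : Slice) : Prop :=
  ∃ l₁ l₂ : List SliceEdge,
    Enumerates l₁ (S.edges.filter fun e => e.src ≠ e.tgt) ∧
    Enumerates l₂ (S.edges.filter fun e => e.src = e.tgt) ∧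
    d = .cons (.atom S.arity) (.cons (centerCode S.center)
      (.cons (.ofList (l₁.map SliceEdge.code)) (.ofList (l₂.map SliceEdge.code))))

/-- `d` presents the term: a slice followed by the list of the subterms. -/
def SliceTerm.Presents : SExpr → SliceTerm → Prop
  | d, .nullary S => ∃ s, Slice.Presents s S ∧ d = .cons s (.ofList [])
  | d, .unary S t => ∃ s d₁, Slice.Presents s S ∧ SliceTerm.Presents d₁ t ∧
      d = .cons s (.ofList [d₁])
  | d, .binary S t₁ t₂ => ∃ s d₁ d₂, Slice.Presents s S ∧ SliceTerm.Presents d₁ t₁ ∧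
      SliceTerm.Presents d₂ t₂ ∧ d = .cons s (.ofList [d₁, d₂])

def stateCode {n : ℕ} (r : Fin n) : SExpr := .atom r.1

/-- `d` presents the transition `τ`. -/
def TransitionPresents {n : ℕ} (d : SExpr) (τ : List (Fin n) × Slice × Fin n) : Prop :=
  ∃ s, Slice.Presents s τ.2.1 ∧
    d = .cons (.ofList (τ.1.map stateCode)) (.cons s (stateCode τ.2.2))

/-- `d` presents the automaton `M`: the lists of its states, final states and transitions. -/
def TreeAutomaton.Presents (d : SExpr) (M : TreeAutomaton) : Prop :=
  ∃ (lF : List (Fin M.numStates)) (lT : List (List (Fin M.numStates) × Slice × Fin M.numStates))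
    (ds : List SExpr),
    Enumerates lF M.final ∧ Enumerates lT M.trans ∧ List.Forall₂ TransitionPresents ds lT ∧
    d = .cons (.ofList ((List.finRange M.numStates).map stateCode))
      (.cons (.ofList (lF.map stateCode)) (.ofList ds))

end SliceCount

/-! ### Subslices -/

namespace SliceCount

namespace Slice

/-! Subgraphs of the digraph of `T` are turned into subterms of `T`, and the accepted subterms are
counted by dynamic programming along `T`.

A subgraph `H` determines the subterm `ofSub H`, which keeps the centers of the vertices of `H` and
the pieces of its edges. Conversely, a subterm has a digraph that embeds in that of `T`. These
operations are mutually inverse on subterms that are unit decompositions, because every piece of a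
unit decomposition lies on exactly one sliced edge sequence (`exists_edgeSequence`,
`EdgeSequence.eq_of_mem`). The reason is that a chain of pieces first climbs in the tree and then
descends without ever turning up again. Hence `Piece.rank` strictly increases along it, no chain is
cyclic, and a maximal chain ends at centers on both sides.

If `H` lies in the graph language, then `ofSub H` is accepted, by saturation. For this its width
must be at most `k * z`: the vertices of the out-frontier at `p` inject into the edges that cross
the cut at `p` (`card_frontier_zero_le`), and each of the `k` paths covering `H` crosses that cut at
most `z` times, since zig-zag bounds pass to subterms. So the wanted number is the number of
accepted subterms (`card_sub_eq_card_subterm`).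

By determinism a subterm has at most one run, so the number of subterms of `t` leading to a state is
a sum, over the transitions whose slice is a subslice of the root of `t`, of products of such
numbers for the children (`Deterministic.card_runSet`). The program computes one table per position.
Its numbers are at most `M.trans.card ^ t.size`, so they have polynomially many bits. Each non-loop
edge uses up a frontier vertex, which bounds the cost of comparing slices in terms of `k * z` and
`q`. Loops at centers are not bounded in this way, but a union of simple paths has no loops, so
transitions with loops are discarded (`language_loopless`) and the loops of `T` are never read. -/

theorem eq_of_fields {S S' : Slice} (ha : S.arity = S'.arity) (hc : S.center = S'.center)
    (he : S.edges = S'.edges) : S = S' := by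
  cases S; cases S'; simp_all

theorem mem_frontier {S : Slice} {j i : ℕ} :
    i ∈ S.frontier j ↔ ∃ e ∈ S.edges, e.Incident (.frontier j i) := by
  have key : ∀ v : SliceVertex, i ∈ v.indices j ↔ v = .frontier j i := by
    intro v
    cases v with
    | center => simp [SliceVertex.indices]
    | frontier j' i' =>
      by_cases h : j' = j
      · simp [SliceVertex.indices, h, eq_comm]
      · simp [SliceVertex.indices, h]
  simp [frontier, key, SliceEdge.Incident]

/-- `S'` arises from `S` by deleting edges and possibly the center vertex. -/
def IsSub (S' S : Slice) : Prop :=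
  S'.arity = S.arity ∧ (S'.center = none ∨ S'.center = S.center) ∧ S'.edges ⊆ S.edges

/-- Keep the center vertex if `c` holds, and the edges that satisfy `E`, except that edges at a
deleted center vertex are deleted as well. -/
noncomputable def restrict (S : Slice) (c : Prop) (E : SliceEdge → Prop) : Slice :=
  open Classical in
  { arity := S.arity
    center := if c then S.center else none
    edges := S.edges.filter fun e => E e ∧ (e.Incident .center → c)
    center_of_incident := by
      intro e he hi
      simp only [Finset.mem_filter] at he
      simpa [he.2.2 hi] using S.center_of_incident e he.1 hi
    frontier_of_incident := fun e he =>
      S.frontier_of_incident e (Finset.mem_filter.1 he).1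
    not_same_frontier := fun e he => S.not_same_frontier e (Finset.mem_filter.1 he).1
    unique_edge := fun e he e' he' =>
      S.unique_edge e (Finset.mem_filter.1 he).1 e' (Finset.mem_filter.1 he').1 }

theorem mem_restrict {S : Slice} {c : Prop} {E : SliceEdge → Prop} {e : SliceEdge} :
    e ∈ (S.restrict c E).edges ↔ e ∈ S.edges ∧ E e ∧ (e.Incident .center → c) := by
  simp [restrict]

theorem restrict_isSub (S : Slice) (c : Prop) (E : SliceEdge → Prop) :
    (S.restrict c E).IsSub S := by
  refine ⟨rfl, ?_, fun e he => (mem_restrict.1 he).1⟩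
  by_cases h : c <;> simp [restrict, h]

theorem IsSub.frontier_subset {S' S : Slice} (h : S'.IsSub S) (j : ℕ) :
    S'.frontier j ⊆ S.frontier j := by
  intro i hi
  obtain ⟨e, he, hi⟩ := mem_frontier.1 hi
  exact mem_frontier.2 ⟨e, h.2.2 he, hi⟩

theorem frontier_eq_empty {S : Slice} {j : ℕ} (h : S.arity < j) : S.frontier j = ∅ := by
  ext i
  simp only [mem_frontier, Finset.notMem_empty, iff_false, not_exists, not_and]
  intro e he hi
  have := (S.frontier_of_incident e he j i hi).1
  omega

end Slice

namespace SliceTerm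

/-! ### Positions -/

@[simp] theorem get?_nil (t : SliceTerm) : t.get? [] = some t.root := by
  cases t <;> rfl

theorem get?_nullary_cons (S : Slice) (a : ℕ) (p : List ℕ) :
    (nullary S).get? (a :: p) = none := by
  simp [get?]

theorem get?_unary_cons (S : Slice) (t : SliceTerm) (a : ℕ) (p : List ℕ) :
    (unary S t).get? (a :: p) = if a = 1 then t.get? p else none := by
  split_ifs with h
  · subst h; rfl
  · simp [get?, h]

theorem get?_binary_cons (S : Slice) (t₁ t₂ : SliceTerm) (a : ℕ) (p : List ℕ) :
    (binary S t₁ t₂).get? (a :: p) =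
      if a = 1 then t₁.get? p else if a = 2 then t₂.get? p else none := by
  split_ifs with h h
  · subst h; rfl
  · subst h; rfl
  · simp [get?, *]

theorem get?_append_singleton {t : SliceTerm} {p : List ℕ} {j : ℕ} {S' : Slice}
    (h : t.get? (p ++ [j]) = some S') : (∃ S, t.get? p = some S) ∧ (j = 1 ∨ j = 2) := by
  induction p generalizing t with
  | nil =>
    refine ⟨⟨_, get?_nil t⟩, ?_⟩
    cases t <;> simp only [List.nil_append, get?_nullary_cons, get?_unary_cons,
      get?_binary_cons] at h
    · simp at h
    · split_ifs at h
      simp_all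
    · split_ifs at h <;> simp_all
  | cons a p ih =>
    cases t <;> simp only [List.cons_append, get?_nullary_cons, get?_unary_cons,
      get?_binary_cons] at h ⊢
    · simp at h
    · split_ifs at h ⊢
      exact ih h
    · split_ifs at h ⊢ <;> exact ih h

theorem get?_child {A : Set Slice} {t : SliceTerm} (ht : t.Over A) {p : List ℕ} {S : Slice}
    (h : t.get? p = some S) {j : ℕ} (h1 : 1 ≤ j) (h2 : j ≤ S.arity) :
    ∃ S', t.get? (p ++ [j]) = some S' := by
  induction p generalizing t with
  | nil =>
    simp only [get?_nil, Option.some.injEq] at h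
    subst h
    cases t with
    | nullary S => simp [root, Over] at *; omega
    | unary S t =>
      simp only [root, Over] at *
      have : j = 1 := by omega
      simp [get?_unary_cons, this]
    | binary S t₁ t₂ =>
      simp only [root, Over] at *
      rcases (by omega : j = 1 ∨ j = 2) with rfl | rfl <;> simp [get?_binary_cons]
  | cons a p ih =>
    cases t <;> simp only [Over, List.cons_append, get?_nullary_cons, get?_unary_cons,
      get?_binary_cons] at ht h ⊢
    · simp at h
    · split_ifs at h ⊢
      exact ih ht.2.2 h
    · split_ifs at h ⊢
      · exact ih ht.2.2.1 h
      · exact ih ht.2.2.2 h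

theorem get?_mem {A : Set Slice} {t : SliceTerm} (ht : t.Over A) {p : List ℕ} {S : Slice}
    (h : t.get? p = some S) : S ∈ A := by
  induction p generalizing t with
  | nil => cases t <;> simp_all [Over, root]
  | cons a p ih =>
    cases t <;> simp only [Over, get?_nullary_cons, get?_unary_cons, get?_binary_cons] at ht h
    · simp at h
    · split_ifs at h; exact ih ht.2.2 h
    · split_ifs at h
      · exact ih ht.2.2.1 h
      · exact ih ht.2.2.2 h

theorem mem_pos {t : SliceTerm} {p : List ℕ} : p ∈ t.pos ↔ ∃ S, t.get? p = some S := by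
  induction t generalizing p with
  | nullary S => cases p <;> simp [pos, get?_nullary_cons]
  | unary S t ih =>
    cases p with
    | nil => simp [pos]
    | cons a p =>
      simp only [pos, get?_unary_cons]
      by_cases h : a = 1
      · simp [h, ih]
      · simp [h, Ne.symm h]
  | binary S t₁ t₂ ih₁ ih₂ =>
    cases p with
    | nil => simp [pos]
    | cons a p =>
      simp only [pos, get?_binary_cons]
      by_cases h : a = 1
      · simp [h, ih₁]
      · by_cases h' : a = 2
        · simp [h', ih₂]
        · simp [h, h', Ne.symm h, Ne.symm h']

theorem digits_of_mem_pos {t : SliceTerm} {p : List ℕ} (h : p ∈ t.pos) :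
    ∀ j ∈ p, j = 1 ∨ j = 2 := by
  induction t generalizing p with
  | nullary S => simp_all [pos]
  | unary S t ih =>
    simp only [pos, Finset.mem_union, Finset.mem_singleton, Finset.mem_image] at h
    rcases h with rfl | ⟨p, hp, rfl⟩
    · simp
    · simpa using ih hp
  | binary S t₁ t₂ ih₁ ih₂ =>
    simp only [pos, Finset.mem_union, Finset.mem_singleton, Finset.mem_image] at h
    rcases h with (rfl | ⟨p, hp, rfl⟩) | ⟨p, hp, rfl⟩
    · simp
    · simpa using ih₁ hp
    · simpa using ih₂ hp

theorem well_numbered_pos {t : SliceTerm} {p : List ℕ} (h : p ++ [2] ∈ t.pos) :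
    p ++ [1] ∈ t.pos := by
  simp only [mem_pos] at *
  induction p generalizing t with
  | nil => cases t <;> simp_all [get?_nullary_cons, get?_unary_cons, get?_binary_cons]
  | cons a p ih =>
    cases t <;> simp only [List.cons_append, get?_nullary_cons, get?_unary_cons,
      get?_binary_cons] at h ⊢
    · exact h
    · split_ifs at h ⊢
      · exact ih h
      · exact h
    · split_ifs at h ⊢
      · exact ih h
      · exact ih h
      · exact h

theorem size_nullary (S : Slice) : (nullary S).size = 1 := by simp [size, pos]

theorem size_unary (S : Slice) (t : SliceTerm) : (unary S t).size = t.size + 1 := by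
  rw [size, pos, Finset.card_union_of_disjoint (by simp),
    Finset.card_image_of_injective _ (List.cons_injective)]
  simp [size, add_comm]

theorem size_binary (S : Slice) (t₁ t₂ : SliceTerm) :
    (binary S t₁ t₂).size = t₁.size + t₂.size + 1 := by
  rw [size, pos, Finset.card_union_of_disjoint, Finset.card_union_of_disjoint (by simp),
    Finset.card_image_of_injective _ (List.cons_injective),
    Finset.card_image_of_injective _ (List.cons_injective)]
  · simp [size]; omega
  · rw [Finset.disjoint_left]
    intro p hp
    simp only [Finset.mem_union, Finset.mem_singleton, Finset.mem_image] at hp ⊢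
    rcases hp with rfl | ⟨p, hp, rfl⟩ <;> simp

theorem exists_depth (t : SliceTerm) : ∃ D, ∀ p ∈ t.pos, p.length ≤ D :=
  ⟨t.pos.sup List.length, fun _ hp => Finset.le_sup (f := List.length) hp⟩

/-! ### Subterms obtained by restricting the slices -/

/-- `t'` arises from `t` by replacing each slice by a subslice. -/
def IsSub : SliceTerm → SliceTerm → Prop
  | nullary S', nullary S => S'.IsSub S
  | unary S' t', unary S t => S'.IsSub S ∧ IsSub t' t
  | binary S' t₁' t₂', binary S t₁ t₂ => S'.IsSub S ∧ IsSub t₁' t₁ ∧ IsSub t₂' t₂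
  | _, _ => False

theorem IsSub.get? {t' t : SliceTerm} (h : IsSub t' t) (p : List ℕ) :
    (t'.get? p = none ∧ t.get? p = none) ∨
      ∃ S' S, t'.get? p = some S' ∧ t.get? p = some S ∧ S'.IsSub S := by
  induction p generalizing t' t with
  | nil => cases t' <;> cases t <;> simp_all [IsSub, root]
  | cons a p ih =>
    cases t' <;> cases t <;> simp only [IsSub] at h <;>
      simp only [get?_nullary_cons, get?_unary_cons, get?_binary_cons]
    · simp
    · split_ifs
      · exact ih h.2
      · simp
    · split_ifs
      · exact ih h.2.1
      · exact ih h.2.2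
      · simp

theorem IsSub.get?_some {t' t : SliceTerm} (h : IsSub t' t) {p : List ℕ} {S' : Slice}
    (hp : t'.get? p = some S') : ∃ S, t.get? p = some S ∧ S'.IsSub S := by
  rcases h.get? p with h | ⟨S₁, S, h1, h2, h3⟩
  · simp [h.1] at hp
  · rw [hp] at h1
    cases h1
    exact ⟨S, h2, h3⟩

/-- The common superterm fixes the shape of both terms, so they can be compared position by
position. -/
theorem IsSub.eq_of_get? {t₁ t₂ t : SliceTerm} (h₁ : IsSub t₁ t) (h₂ : IsSub t₂ t)
    (h : ∀ p, t₁.get? p = t₂.get? p) : t₁ = t₂ := by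
  induction t generalizing t₁ t₂ with
  | nullary S =>
    cases t₁ <;> cases t₂ <;> simp only [IsSub] at h₁ h₂
    simpa [root] using h []
  | unary S t ih =>
    cases t₁ <;> cases t₂ <;> simp only [IsSub] at h₁ h₂
    rw [ih h₁.2 h₂.2 fun p => by simpa [get?_unary_cons] using h (1 :: p)]
    simpa [root] using h []
  | binary S t t' ih ih' =>
    cases t₁ <;> cases t₂ <;> simp only [IsSub] at h₁ h₂
    rw [ih h₁.2.1 h₂.2.1 fun p => by simpa [get?_binary_cons] using h (1 :: p),
      ih' h₁.2.2 h₂.2.2 fun p => by simpa [get?_binary_cons] using h (2 :: p)]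
    simpa [root] using h []

theorem IsSub.over {t' t : SliceTerm} (h : IsSub t' t) {A A' : Set Slice} (ht : t.Over A)
    (hA : ∀ p S, t'.get? p = some S → S ∈ A') : t'.Over A' := by
  induction t generalizing t' with
  | nullary S =>
    cases t' <;> simp only [IsSub, Over] at h ht ⊢
    exact ⟨hA [] _ (by simp [root]), h.1.trans ht.2⟩
  | unary S t ih =>
    cases t' <;> simp only [IsSub, Over] at h ht ⊢
    exact ⟨hA [] _ (by simp [root]), h.1.1.trans ht.2.1,
      ih h.2 ht.2.2 fun p S hp => hA (1 :: p) S (by simpa [get?_unary_cons] using hp)⟩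
  | binary S t₁ t₂ ih₁ ih₂ =>
    cases t' <;> simp only [IsSub, Over] at h ht ⊢
    exact ⟨hA [] _ (by simp [root]), h.1.1.trans ht.2.1,
      ih₁ h.2.1 ht.2.2.1 fun p S hp => hA (1 :: p) S (by simpa [get?_binary_cons] using hp),
      ih₂ h.2.2 ht.2.2.2 fun p S hp => hA (2 :: p) S (by simpa [get?_binary_cons] using hp)⟩

/-- Restrict the slice at each position. -/
noncomputable def restrict (c : List ℕ → Prop) (E : List ℕ → SliceEdge → Prop) :
    SliceTerm → SliceTerm
  | nullary S => nullary (S.restrict (c []) (E []))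
  | unary S t => unary (S.restrict (c []) (E []))
      (restrict (fun p => c (1 :: p)) (fun p => E (1 :: p)) t)
  | binary S t₁ t₂ => binary (S.restrict (c []) (E []))
      (restrict (fun p => c (1 :: p)) (fun p => E (1 :: p)) t₁)
      (restrict (fun p => c (2 :: p)) (fun p => E (2 :: p)) t₂)

theorem get?_restrict (c : List ℕ → Prop) (E : List ℕ → SliceEdge → Prop) (t : SliceTerm)
    (p : List ℕ) :
    (t.restrict c E).get? p = (t.get? p).map fun S => S.restrict (c p) (E p) := by
  induction t generalizing p c E with
  | nullary S => cases p <;> simp [restrict, root, get?_nullary_cons]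
  | unary S t ih =>
    cases p with
    | nil => simp [restrict, root]
    | cons a p =>
      simp only [restrict, get?_unary_cons]
      split_ifs with h
      · subst h; exact ih _ _ _
      · rfl
  | binary S t₁ t₂ ih₁ ih₂ =>
    cases p with
    | nil => simp [restrict, root]
    | cons a p =>
      simp only [restrict, get?_binary_cons]
      split_ifs with h h
      · subst h; exact ih₁ _ _ _
      · subst h; exact ih₂ _ _ _
      · rfl

theorem restrict_isSub (c : List ℕ → Prop) (E : List ℕ → SliceEdge → Prop) (t : SliceTerm) :
    (t.restrict c E).IsSub t := by
  induction t generalizing c E with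
  | nullary S => exact S.restrict_isSub _ _
  | unary S t ih => exact ⟨S.restrict_isSub _ _, ih _ _⟩
  | binary S t₁ t₂ ih₁ ih₂ => exact ⟨S.restrict_isSub _ _, ih₁ _ _, ih₂ _ _⟩

end SliceTerm

end SliceCount

namespace SliceCount

/-! ### Chains -/

theorem isChain_forall_of_step {α : Type*} {R : α → α → Prop} {P Q : α → Prop}
    (step : ∀ x y, P x → P y → R x y → Q x → Q y) {x : α} {l : List α}
    (hl : (x :: l).IsChain R) (hP : ∀ w ∈ x :: l, P w) (hx : Q x) : ∀ w ∈ x :: l, Q w := by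
  induction l generalizing x with
  | nil => simpa using hx
  | cons y l ih =>
    rw [List.isChain_cons_cons] at hl
    have hy : Q y := step x y (hP x (by simp)) (hP y (by simp)) hl.1 hx
    intro w hw
    rcases List.mem_cons.1 hw with rfl | hw
    · exact hx
    · exact ih hl.2 (fun w hw => hP w (List.mem_cons_of_mem _ hw)) hy w hw

/-- Two maximal chains of a functional relation that start at the same element are equal. -/
theorem isChain_unique {α : Type*} {R : α → α → Prop} {P : α → Prop}
    (uniq : ∀ x y y', P y → P y' → R x y → R x y' → y = y') {x : α} {l l' : List α}
    (hl : (x :: l).IsChain R) (hl' : (x :: l').IsChain R) (hP : ∀ w ∈ x :: l, P w)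
    (hP' : ∀ w ∈ x :: l', P w)
    (hend : ∀ w, (x :: l).getLast? = some w → ∀ y, ¬ R w y)
    (hend' : ∀ w, (x :: l').getLast? = some w → ∀ y, ¬ R w y) : l = l' := by
  induction l generalizing x l' with
  | nil =>
    cases l' with
    | nil => rfl
    | cons y' l' => exact absurd (List.isChain_cons_cons.1 hl').1 (hend x (by simp) y')
  | cons y l ih =>
    rw [List.isChain_cons_cons] at hl
    cases l' with
    | nil => exact absurd hl.1 (hend' x (by simp) y)
    | cons y' l' =>
      rw [List.isChain_cons_cons] at hl'
      obtain rfl := uniq x y y' (hP y (by simp)) (hP' y' (by simp)) hl.1 hl'.1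
      rw [ih hl.2 hl'.2 (fun w hw => hP w (List.mem_cons_of_mem _ hw))
        (fun w hw => hP' w (List.mem_cons_of_mem _ hw))
        (fun w hw => hend w (by simpa [List.getLast?_cons_cons] using hw))
        (fun w hw => hend' w (by simpa [List.getLast?_cons_cons] using hw))]

namespace SliceTerm

theorem Piece.eq_of_fields {x y : Piece} (hp : x.position = y.position) (he : x.edge = y.edge) :
    x = y := by
  cases x; cases y; simp_all

/-- The edge of the piece does not return to the frontier that it comes from, and all digits of the
position are positive. -/
def Piece.Proper (x : Piece) : Prop :=
  (∀ j i i', ¬ (x.edge.src = .frontier j i ∧ x.edge.tgt = .frontier j i')) ∧ 0 ∉ x.position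

/-- The same piece, traversed in the opposite direction. -/
def Piece.rev (x : Piece) : Piece := ⟨x.position, ⟨x.edge.tgt, x.edge.src, x.edge.label⟩⟩

theorem Piece.Proper.rev {x : Piece} (hx : x.Proper) : x.rev.Proper :=
  ⟨fun j i i' h => hx.1 j i' i ⟨h.2, h.1⟩, hx.2⟩

theorem Piece.Next.rev {x y : Piece} (h : x.Next y) : y.rev.Next x.rev := by
  obtain ⟨j, i, h | h⟩ := h
  · exact ⟨j, i, Or.inr ⟨h.1, h.2.2, h.2.1⟩⟩
  · exact ⟨j, i, Or.inl ⟨h.1, h.2.2, h.2.1⟩⟩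

theorem isChain_reverse_rev {l : List Piece} (h : l.IsChain Piece.Next) :
    (l.reverse.map Piece.rev).IsChain Piece.Next := by
  rw [List.isChain_map, List.isChain_reverse]
  exact h.imp fun _ _ h => h.rev

/-- The piece leads to the parent position. -/
def Piece.IsUp (x : Piece) : Prop := ∃ i, x.edge.tgt = .frontier 0 i

/-- A step down enters `y` through its out-frontier, and `y` cannot return to the frontier it comes
from. Therefore a chain that has started to descend never climbs again. -/
theorem Piece.Next.cases {x y : Piece} (hx : x.Proper) (hy : y.Proper) (h : x.Next y) :
    (∃ i j, j ≠ 0 ∧ x.position = y.position ++ [j] ∧ x.edge.tgt = .frontier 0 i ∧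
        y.edge.src = .frontier j i) ∨
      (∃ i j, j ≠ 0 ∧ y.position = x.position ++ [j] ∧ x.edge.tgt = .frontier j i ∧
        y.edge.src = .frontier 0 i ∧ ¬ x.IsUp ∧ ¬ y.IsUp) := by
  obtain ⟨j, i, h | h⟩ := h
  · left
    refine ⟨i, j, ?_, h⟩
    rintro rfl
    exact hx.2 (by simp [h.1])
  · right
    have hj : j ≠ 0 := by
      rintro rfl
      exact hy.2 (by simp [h.1])
    refine ⟨i, j, hj, h.1, h.2.1, h.2.2, ?_, ?_⟩
    · rintro ⟨i', hi'⟩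
      rw [h.2.1] at hi'
      simp_all
    · rintro ⟨i', hi'⟩
      exact hy.1 0 i i' ⟨h.2.2, hi'⟩

open Classical in
/-- A number that increases along chains of pieces. -/
noncomputable def Piece.rank (x : Piece) : ℤ :=
  if x.IsUp then -(x.position.length : ℤ) else x.position.length + 1

/-- While a chain climbs, the rank is minus the depth, which is at most `0` and increases. After the
turn it is the depth plus one, which is at least `1` and increases too. -/
theorem Piece.Next.rank_lt {x y : Piece} (hx : x.Proper) (hy : y.Proper) (h : x.Next y) :
    x.rank < y.rank := by
  rcases h.cases hx hy with ⟨i, j, -, hp, ht, -⟩ | ⟨i, j, -, hp, -, -, hux, huy⟩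
  · have hux : x.IsUp := ⟨i, ht⟩
    by_cases huy : y.IsUp <;> simp only [rank, hux, huy, if_true, if_false, hp]
    · simp
    · simp
      omega
  · simp [rank, hux, huy, hp]

/-- Strict monotonicity of the rank: a chain visits each position at most once with a climbing piece
and at most once with another piece. -/
theorem eq_of_rank_eq {l : List Piece} (hl : l.IsChain Piece.Next) (hP : ∀ w ∈ l, w.Proper)
    {x y : Piece} (hx : x ∈ l) (hy : y ∈ l) (h : x.rank = y.rank) : x = y := by
  have h1 : l.IsChain fun x y => x.rank < y.rank :=
    hl.imp_of_mem_imp fun a b ha hb hab => hab.rank_lt (hP a ha) (hP b hb)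
  have : IsTrans Piece fun x y => x.rank < y.rank := ⟨fun _ _ _ => lt_trans⟩
  have h2 : l.Pairwise fun x y => x.rank ≠ y.rank :=
    (List.isChain_iff_pairwise.1 h1).imp fun h => h.ne
  have : Std.Symm fun x y : Piece => x.rank ≠ y.rank := ⟨fun _ _ h => h.symm⟩
  by_contra hne
  exact h2.forall hx hy hne h

/-- A chain that leaves the subtree at `p` does not return to it. -/
theorem not_prefix_of_isUp {x : Piece} {l : List Piece} (hl : (x :: l).IsChain Piece.Next)
    (hP : ∀ w ∈ x :: l, w.Proper) (hx : x.IsUp) :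
    ∀ w ∈ l, ¬ x.position <+: w.position := by
  cases l with
  | nil => simp
  | cons y l =>
    set p := x.position with hp
    -- The invariant: either `w` is strictly above `p` and was entered from the child in the
    -- direction of `p`, or the chain has branched off from the way to `p` at the node `a` and is
    -- descending.
    let Q : Piece → Prop := fun w =>
      (∃ j i, w.position ++ [j] <+: p ∧ w.edge.src = .frontier j i) ∨
      (∃ a j₁ j₂, j₁ ≠ j₂ ∧ a ++ [j₁] <+: p ∧ a ++ [j₂] <+: w.position ∧ ¬ w.IsUp)
    have hQ : ∀ w, Q w → ¬ p <+: w.position := by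
      rintro w (⟨j, i, h, -⟩ | ⟨a, j₁, j₂, hj, h1, h2, -⟩) hw
      · have := (h.trans hw).length_le
        simp at this
      · have h3 := List.prefix_of_prefix_length_le (h1.trans hw) h2 (by simp)
        have := h3.eq_of_length (by simp)
        simp_all
    have hstep : ∀ x y : Piece, x.Proper → y.Proper → x.Next y → Q x → Q y := by
      intro x y hx hy hxy hQx
      rcases hxy.cases hx hy with ⟨i, j, -, hp, ht, hs⟩ | ⟨i, j, hj, hp, ht, hs, hux, huy⟩
      · rcases hQx with ⟨j', i', h, -⟩ | ⟨a, j₁, j₂, -, -, -, hu⟩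
        · refine Or.inl ⟨j, i, ?_, hs⟩
          rw [← hp]
          exact (List.prefix_append _ _).trans h
        · exact absurd ⟨i, ht⟩ hu
      · rcases hQx with ⟨j', i', h, h'⟩ | ⟨a, j₁, j₂, hj, h1, h2, hu⟩
        · refine Or.inr ⟨x.position, j', j, ?_, h, by rw [hp], huy⟩
          rintro rfl
          exact hx.1 _ _ _ ⟨h', ht⟩
        · refine Or.inr ⟨a, j₁, j₂, hj, h1, ?_, huy⟩
          rw [hp]
          exact h2.trans (List.prefix_append _ _)
    rw [List.isChain_cons_cons] at hl
    have hy : Q y := by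
      rcases hl.1.cases (hP x (by simp)) (hP y (by simp)) with
        ⟨i, j, -, hp, ht, hs⟩ | ⟨i, j, -, -, -, -, hux, -⟩
      · exact Or.inl ⟨j, i, by rw [← hp], hs⟩
      · exact absurd hx hux
    exact fun w hw => hQ w (isChain_forall_of_step hstep hl.2
      (fun w hw => hP w (List.mem_cons_of_mem _ hw)) hy w hw)

/-- A chain that goes down stays below. -/
theorem prefix_of_not_isUp {x : Piece} {l : List Piece} (hl : (x :: l).IsChain Piece.Next)
    (hP : ∀ w ∈ x :: l, w.Proper) (hx : ¬ x.IsUp) :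
    ∀ w ∈ x :: l, x.position <+: w.position := by
  have := isChain_forall_of_step (Q := fun w => ¬ w.IsUp ∧ x.position <+: w.position)
    (fun a b ha hb hab hQ => ?_) hl hP ⟨hx, List.prefix_refl _⟩
  · exact fun w hw => (this w hw).2
  · rcases hab.cases ha hb with ⟨i, j, -, -, ht, -⟩ | ⟨i, j, -, hp, -, -, -, hub⟩
    · exact absurd ⟨i, ht⟩ hQ.1
    · exact ⟨hub, hp ▸ hQ.2.trans (List.prefix_append _ _)⟩

/-- The part before `x`, read backwards, starts with a piece that does not go up, hence stays below.
The part after `x` has left the subtree for good. So the chain crosses the cut at this position only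
once. -/
theorem prefix_iff_of_tgt {A B : List Piece} {x : Piece} {i : ℕ}
    (hl : (A ++ x :: B).IsChain Piece.Next) (hP : ∀ w ∈ A ++ x :: B, w.Proper)
    (hx : x.edge.tgt = .frontier 0 i) :
    (∀ w ∈ A, x.position <+: w.position) ∧ ∀ w ∈ B, ¬ x.position <+: w.position := by
  constructor
  · have h1 := isChain_reverse_rev hl
    simp only [List.reverse_append, List.reverse_cons, List.append_assoc, List.map_append,
      List.map_cons, List.cons_append, List.nil_append] at h1
    have h2 := h1.right_of_append
    have h3 := prefix_of_not_isUp h2 ?_ ?_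
    · intro w hw
      simpa [Piece.rev] using h3 w.rev (by
        refine List.mem_cons_of_mem _ ?_
        exact List.mem_map_of_mem (by simpa using hw))
    · intro w hw
      rcases List.mem_cons.1 hw with rfl | hw
      · exact (hP x (by simp)).rev
      · obtain ⟨w', hw', rfl⟩ := List.mem_map.1 hw
        exact (hP w' (List.mem_append_left _ (List.mem_reverse.1 hw'))).rev
    · rintro ⟨i', hi'⟩
      exact (hP x (by simp)).1 0 i' i ⟨hi', hx⟩
  · exact not_prefix_of_isUp hl.right_of_append
      (fun w hw => hP w (List.mem_append_right _ hw)) ⟨i, hx⟩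

/-- Reversing the chain exchanges the two directions of crossing, which reduces this to
`prefix_iff_of_tgt`. -/
theorem prefix_iff_of_src {A B : List Piece} {x : Piece} {i : ℕ}
    (hl : (A ++ x :: B).IsChain Piece.Next) (hP : ∀ w ∈ A ++ x :: B, w.Proper)
    (hx : x.edge.src = .frontier 0 i) :
    (∀ w ∈ B, x.position <+: w.position) ∧ ∀ w ∈ A, ¬ x.position <+: w.position := by
  have h1 := isChain_reverse_rev hl
  simp only [List.reverse_append, List.reverse_cons, List.append_assoc, List.map_append,
    List.map_cons, List.cons_append, List.nil_append] at h1
  have h2 := prefix_iff_of_tgt h1 ?_ (i := i) hx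
  · constructor
    · intro w hw
      simpa [Piece.rev] using h2.1 w.rev (List.mem_map_of_mem (by simpa using hw))
    · intro w hw
      simpa [Piece.rev] using h2.2 w.rev (List.mem_map_of_mem (by simpa using hw))
  · intro w hw
    have : ∃ w' ∈ A ++ x :: B, w = w'.rev := by
      simp only [List.mem_append, List.mem_map, List.mem_reverse, List.mem_cons] at hw ⊢
      rcases hw with ⟨w, hw, rfl⟩ | rfl | ⟨w, hw, rfl⟩
      · exact ⟨w, Or.inr (Or.inr hw), rfl⟩
      · exact ⟨x, Or.inr (Or.inl rfl), rfl⟩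
      · exact ⟨w, Or.inl hw, rfl⟩
    obtain ⟨w', hw', rfl⟩ := this
    exact (hP w' hw').rev

/-! ### Pieces of a unit decomposition -/

/-- `x` is a position of `t` together with an edge of the slice there. -/
def HasPiece (t : SliceTerm) (x : Piece) : Prop :=
  ∃ S, t.get? x.position = some S ∧ x.edge ∈ S.edges

variable {t : SliceTerm}

theorem HasPiece.proper {x : Piece} (h : t.HasPiece x) : x.Proper := by
  obtain ⟨S, hS, he⟩ := h
  refine ⟨S.not_same_frontier _ he, fun h0 => ?_⟩
  have := digits_of_mem_pos (mem_pos.2 ⟨S, hS⟩) 0 h0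
  omega

/-- The target of `x` determines the neighboring position and the frontier vertex matched there, and
that vertex is an endpoint of only one edge. -/
theorem next_unique {x y y' : Piece} (hx : t.HasPiece x) (hy : t.HasPiece y)
    (hy' : t.HasPiece y') (h : x.Next y) (h' : x.Next y') : y = y' := by
  have key : y.position = y'.position ∧ ∃ j i, y.edge.src = .frontier j i ∧
      y'.edge.src = .frontier j i := by
    rcases h.cases hx.proper hy.proper with ⟨i, j, hj, hp, ht, hs⟩ | ⟨i, j, hj, hp, ht, hs, -⟩ <;>
    rcases h'.cases hx.proper hy'.proper with
      ⟨i', j', hj', hp', ht', hs'⟩ | ⟨i', j', hj', hp', ht', hs', -⟩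
    · rw [hp] at hp'
      rw [ht] at ht'
      have := List.append_inj' hp' rfl
      simp only [SliceVertex.frontier.injEq, true_and, List.cons.injEq, and_true] at ht' this
      exact ⟨this.1, j, i, hs, by rw [hs', this.2, ht']⟩
    · rw [ht] at ht'
      simp only [SliceVertex.frontier.injEq] at ht'
      omega
    · rw [ht] at ht'
      simp only [SliceVertex.frontier.injEq] at ht'
      omega
    · rw [ht] at ht'
      simp only [SliceVertex.frontier.injEq] at ht'
      exact ⟨by rw [hp, hp', ht'.1], 0, i, hs, by rw [hs', ht'.2]⟩
  obtain ⟨hp, j, i, hs, hs'⟩ := key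
  obtain ⟨S, hS, he⟩ := hy
  obtain ⟨S', hS', he'⟩ := hy'
  rw [← hp, hS] at hS'
  cases hS'
  exact Piece.eq_of_fields hp (S.unique_edge _ he _ he' j i (Or.inl hs) (Or.inl hs'))

theorem prev_unique {x x' y : Piece} (hx : t.HasPiece x) (hx' : t.HasPiece x')
    (hy : t.HasPiece y) (h : x.Next y) (h' : x'.Next y) : x = x' := by
  have key : x.position = x'.position ∧ ∃ j i, x.edge.tgt = .frontier j i ∧
      x'.edge.tgt = .frontier j i := by
    rcases h.cases hx.proper hy.proper with ⟨i, j, hj, hp, ht, hs⟩ | ⟨i, j, hj, hp, ht, hs, -⟩ <;>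
    rcases h'.cases hx'.proper hy.proper with
      ⟨i', j', hj', hp', ht', hs'⟩ | ⟨i', j', hj', hp', ht', hs', -⟩
    · rw [hs] at hs'
      simp only [SliceVertex.frontier.injEq] at hs'
      exact ⟨by rw [hp, hp', hs'.1], 0, i, ht, by rw [ht', hs'.2]⟩
    · rw [hs] at hs'
      simp only [SliceVertex.frontier.injEq] at hs'
      omega
    · rw [hs] at hs'
      simp only [SliceVertex.frontier.injEq] at hs'
      omega
    · rw [hp] at hp'
      rw [hs] at hs'
      have := List.append_inj' hp' rfl
      simp only [SliceVertex.frontier.injEq, true_and, List.cons.injEq, and_true] at hs' this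
      exact ⟨this.1, j, i, ht, by rw [ht', this.2, hs']⟩
  obtain ⟨hp, j, i, hs, hs'⟩ := key
  obtain ⟨S, hS, he⟩ := hx
  obtain ⟨S', hS', he'⟩ := hx'
  rw [← hp, hS] at hS'
  cases hS'
  exact Piece.eq_of_fields hp (S.unique_edge _ he _ he' j i (Or.inr hs) (Or.inr hs'))

/-- Gluability provides the matching edge on the other side of the frontier, with the right
orientation. Nothing escapes at the root, where the out-frontier is empty, and every frontier `j ≥
1` has a child because the arities are correct. -/
theorem exists_neighbor {A : Set Slice} (hA : t.Over A) (ht : t.IsUnitDecomposition) {x : Piece}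
    (hx : t.HasPiece x) {j i : ℕ} (hv : x.edge.Incident (.frontier j i)) :
    ∃ y, t.HasPiece y ∧ (x.edge.tgt = .frontier j i → x.Next y) ∧
      (x.edge.src = .frontier j i → y.Next x) := by
  obtain ⟨S, hS, he⟩ := hx
  have hns := S.not_same_frontier _ he
  by_cases hj : j = 0
  · subst hj
    rcases List.eq_nil_or_concat x.position with h0 | ⟨p, j, hp⟩
    · have : i ∈ S.frontier 0 := Slice.mem_frontier.2 ⟨_, he, hv⟩
      rw [h0, get?_nil, Option.some.injEq] at hS
      rw [← hS, ht.2] at this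
      simp at this
    · rw [List.concat_eq_append] at hp
      rw [hp] at hS
      obtain ⟨⟨S', hS'⟩, -⟩ := get?_append_singleton hS
      have hg := ht.1 p j S' S hS' hS
      obtain ⟨e', he', hi'⟩ := Slice.mem_frontier.1
        ((hg.2.1 i).1 (Slice.mem_frontier.2 ⟨_, he, hv⟩))
      have := (hg.2.2 i _ he e' he' hv hi').2
      refine ⟨⟨p, e'⟩, ⟨S', hS', he'⟩, fun h => ?_, fun h => ?_⟩
      · rcases this with h1 | h1
        · exact ⟨j, i, Or.inl ⟨hp, h, h1.2⟩⟩
        · exact absurd ⟨h1.1, h⟩ (hns 0 i i)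
      · rcases this with h1 | h1
        · exact absurd ⟨h, h1.1⟩ (hns 0 i i)
        · exact ⟨j, i, Or.inr ⟨hp, h1.2, h⟩⟩
  · have hj2 := (S.frontier_of_incident _ he j i hv).1
    obtain ⟨S', hS'⟩ := get?_child hA hS (Nat.one_le_iff_ne_zero.2 hj) hj2
    have hg := ht.1 _ j S S' hS hS'
    obtain ⟨e', he', hi'⟩ := Slice.mem_frontier.1
      ((hg.2.1 i).2 (Slice.mem_frontier.2 ⟨_, he, hv⟩))
    have := (hg.2.2 i e' he' _ he hi' hv).2
    refine ⟨⟨x.position ++ [j], e'⟩, ⟨S', hS', he'⟩, fun h => ?_, fun h => ?_⟩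
    · rcases this with h1 | h1
      · exact absurd ⟨h1.2, h⟩ (hns j i i)
      · exact ⟨j, i, Or.inr ⟨rfl, h, h1.1⟩⟩
    · rcases this with h1 | h1
      · exact ⟨j, i, Or.inl ⟨rfl, h1.1, h⟩⟩
      · exact absurd ⟨h, h1.2⟩ (hns j i i)

theorem not_next_of_tgt_eq_center {x : Piece} (hx : x.edge.tgt = .center) (y : Piece) :
    ¬ x.Next y := by
  rintro ⟨j, i, h | h⟩
  · rw [hx] at h; simp at h
  · rw [hx] at h; simp at h

theorem not_next_of_src_eq_center {y : Piece} (hy : y.edge.src = .center) (x : Piece) :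
    ¬ x.Next y := by
  rintro ⟨j, i, h | h⟩
  · rw [hy] at h; simp at h
  · rw [hy] at h; simp at h

namespace EdgeSequence

theorem eq_of_pieces {K K' : t.EdgeSequence} (h : K.pieces = K'.pieces) : K = K' := by
  cases K; cases K'; simp_all

theorem hasPiece (K : t.EdgeSequence) {x : Piece} (hx : x ∈ K.pieces) : t.HasPiece x :=
  K.edge_mem x hx

/-- From `x` on, both sequences are forced in either direction by `next_unique` and `prev_unique`,
and they stop only at a center, where no continuation exists. -/
theorem eq_of_mem {K K' : t.EdgeSequence} {x : Piece} (hx : x ∈ K.pieces)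
    (hx' : x ∈ K'.pieces) : K = K' := by
  obtain ⟨A, B, h⟩ := List.append_of_mem hx
  obtain ⟨A', B', h'⟩ := List.append_of_mem hx'
  have hc := K.chain
  have hc' := K'.chain
  have hm : ∀ w ∈ A ++ x :: B, t.HasPiece w := fun w hw => K.hasPiece (h ▸ hw)
  have hm' : ∀ w ∈ A' ++ x :: B', t.HasPiece w := fun w hw => K'.hasPiece (h' ▸ hw)
  have hlast : ∀ w, (x :: B).getLast? = some w → ∀ y, ¬ w.Next y := by
    intro w hw
    have : K.pieces.getLast? = some w := by rw [h]; simp_all [List.getLast?_append]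
    rw [List.getLast?_eq_some_getLast K.ne_nil] at this
    cases this
    exact not_next_of_tgt_eq_center K.tgt_center
  have hlast' : ∀ w, (x :: B').getLast? = some w → ∀ y, ¬ w.Next y := by
    intro w hw
    have : K'.pieces.getLast? = some w := by rw [h']; simp_all [List.getLast?_append]
    rw [List.getLast?_eq_some_getLast K'.ne_nil] at this
    cases this
    exact not_next_of_tgt_eq_center K'.tgt_center
  have hhead : ∀ w, (x :: A.reverse).getLast? = some w → ∀ y : Piece, ¬ y.Next w := by
    intro w hw
    have : K.pieces.head? = some w := by
      rw [h, ← hw]; cases A <;> simp [List.getLast?_cons, List.getLast?_append]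
    rw [List.head?_eq_some_head K.ne_nil] at this
    cases this
    exact not_next_of_src_eq_center K.src_center
  have hhead' : ∀ w, (x :: A'.reverse).getLast? = some w → ∀ y : Piece, ¬ y.Next w := by
    intro w hw
    have : K'.pieces.head? = some w := by
      rw [h', ← hw]; cases A' <;> simp [List.getLast?_cons, List.getLast?_append]
    rw [List.head?_eq_some_head K'.ne_nil] at this
    cases this
    exact not_next_of_src_eq_center K'.src_center
  rw [h] at hc
  rw [h'] at hc'
  have hB : B = B' := by
    -- The relation itself records that `a` is a piece of `t`, since the uniqueness hypothesis of
    -- `isChain_unique` provides `P` for the successors only.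
    refine isChain_unique (R := fun a b => t.HasPiece a ∧ a.Next b) (P := t.HasPiece)
      (fun x y y' hy hy' h h' => next_unique h.1 hy hy' h.2 h'.2)
      (hc.right_of_append.imp_of_mem_imp fun a b ha _ hab =>
        ⟨hm a (List.mem_append_right _ ha), hab⟩)
      (hc'.right_of_append.imp_of_mem_imp fun a b ha _ hab =>
        ⟨hm' a (List.mem_append_right _ ha), hab⟩)
      (fun w hw => hm w (List.mem_append_right _ hw))
      (fun w hw => hm' w (List.mem_append_right _ hw))
      (fun w hw y hy => hlast w hw y hy.2) (fun w hw y hy => hlast' w hw y hy.2)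
  have hrev : ∀ {A B : List Piece}, (A ++ x :: B).IsChain Piece.Next →
      (∀ w ∈ A ++ x :: B, t.HasPiece w) →
      (x :: A.reverse).IsChain fun a b => t.HasPiece a ∧ b.Next a := by
    intro A B hc hm
    have : (A ++ [x]).IsChain Piece.Next := by
      refine hc.prefix ?_
      exact ⟨B, by simp⟩
    have h2 : ((A ++ [x]).reverse).IsChain fun a b => b.Next a := by
      rw [List.isChain_reverse]; exact this
    rw [List.reverse_append, List.reverse_singleton, List.singleton_append] at h2
    refine h2.imp_of_mem_imp fun a b ha _ hab => ⟨hm a ?_, hab⟩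
    simp only [List.mem_cons, List.mem_reverse, List.mem_append] at ha ⊢
    tauto
  have hA : A.reverse = A'.reverse := by
    refine isChain_unique (R := fun a b => t.HasPiece a ∧ b.Next a) (P := t.HasPiece)
      (fun x y y' hy hy' h h' => prev_unique hy hy' h.1 h.2 h'.2) (hrev hc hm) (hrev hc' hm')
      (fun w hw => hm w (by
        simp only [List.mem_cons, List.mem_reverse, List.mem_append] at *; tauto))
      (fun w hw => hm' w (by
        simp only [List.mem_cons, List.mem_reverse, List.mem_append] at *; tauto))
      (fun w hw y hy => hhead w hw y hy.2) (fun w hw y hy => hhead' w hw y hy.2)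
  refine eq_of_pieces ?_
  rw [h, h', hB, List.reverse_injective hA]

/-- A sliced edge sequence cannot stop at a piece that has a successor, since it ends at a center.
The successor is unique. -/
theorem mem_of_next (K : t.EdgeSequence) {x y : Piece} (hx : x ∈ K.pieces) (hy : t.HasPiece y)
    (h : x.Next y) : y ∈ K.pieces := by
  obtain ⟨A, B, hK⟩ := List.append_of_mem hx
  have hc := K.chain
  cases B with
  | nil =>
    have h1 : K.pieces.getLast K.ne_nil = x := by simp [hK]
    exact absurd h (not_next_of_tgt_eq_center (h1 ▸ K.tgt_center) y)
  | cons y' B =>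
    rw [hK] at hc
    have h1 := (List.isChain_cons_cons.1 hc.right_of_append).1
    have hy' : y' ∈ K.pieces := by simp [hK]
    rw [next_unique (K.hasPiece hx) hy (K.hasPiece hy') h h1]
    exact hy'

theorem mem_of_prev (K : t.EdgeSequence) {x y : Piece} (hy : y ∈ K.pieces) (hx : t.HasPiece x)
    (h : x.Next y) : x ∈ K.pieces := by
  obtain ⟨A, B, hK⟩ := List.append_of_mem hy
  have hc := K.chain
  rcases List.eq_nil_or_concat A with rfl | ⟨A, x', rfl⟩
  · have h1 : K.pieces.head K.ne_nil = y := by simp [hK]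
    exact absurd h (not_next_of_src_eq_center (h1 ▸ K.src_center) x)
  · rw [hK] at hc
    have h1 : x'.Next y := by
      simp only [List.concat_eq_append, List.append_assoc, List.cons_append, List.nil_append] at hc
      exact (List.isChain_cons_cons.1 hc.right_of_append).1
    have hx' : x' ∈ K.pieces := by simp [hK]
    rw [prev_unique hx (K.hasPiece hx') (K.hasPiece hy) h h1]
    exact hx'

end EdgeSequence

/-- As long as the target is not a center, `exists_neighbor` extends the chain and the rank grows.
Ranks are at most the depth of `t` plus one, so the process stops; the induction is on the remaining
room. -/
theorem exists_forward {A : Set Slice} (hA : t.Over A) (ht : t.IsUnitDecomposition) {x : Piece}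
    (hx : t.HasPiece x) : ∃ l, (x :: l).IsChain Piece.Next ∧ (∀ w ∈ x :: l, t.HasPiece w) ∧
      ((x :: l).getLast (by simp)).edge.tgt = .center := by
  obtain ⟨D, hD⟩ := t.exists_depth
  obtain ⟨n, hn⟩ : ∃ n : ℕ, (D : ℤ) + 1 - x.rank ≤ n := ⟨_, Int.self_le_toNat _⟩
  induction n generalizing x with
  | zero =>
    cases hv : x.edge.tgt with
    | center => exact ⟨[], by simp, by simpa using hx, by simpa using hv⟩
    | frontier j i =>
      obtain ⟨y, hy, h, -⟩ := exists_neighbor hA ht hx (Or.inr hv)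
      have h1 := (h hv).rank_lt hx.proper hy.proper
      obtain ⟨S, hS, -⟩ := hy
      have h2 := hD _ (mem_pos.2 ⟨S, hS⟩)
      have : y.rank ≤ D + 1 := by
        unfold Piece.rank; split_ifs <;> omega
      omega
  | succ n ih =>
    cases hv : x.edge.tgt with
    | center => exact ⟨[], by simp, by simpa using hx, by simpa using hv⟩
    | frontier j i =>
      obtain ⟨y, hy, h, -⟩ := exists_neighbor hA ht hx (Or.inr hv)
      have h1 := (h hv).rank_lt hx.proper hy.proper
      obtain ⟨l, hl, hm, hlast⟩ := ih hy (by push_cast at hn; omega)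
      refine ⟨y :: l, List.isChain_cons_cons.2 ⟨h hv, hl⟩, ?_, by simpa using hlast⟩
      intro w hw
      rcases List.mem_cons.1 hw with rfl | hw
      · exact hx
      · exact hm w hw

theorem exists_backward {A : Set Slice} (hA : t.Over A) (ht : t.IsUnitDecomposition) {x : Piece}
    (hx : t.HasPiece x) : ∃ l, (l ++ [x]).IsChain Piece.Next ∧ (∀ w ∈ l ++ [x], t.HasPiece w) ∧
      ((l ++ [x]).head (by simp)).edge.src = .center := by
  obtain ⟨D, hD⟩ := t.exists_depth
  obtain ⟨n, hn⟩ : ∃ n : ℕ, (D : ℤ) + x.rank ≤ n := ⟨_, Int.self_le_toNat _⟩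
  induction n generalizing x with
  | zero =>
    cases hv : x.edge.src with
    | center => exact ⟨[], by simp, by simpa using hx, by simpa using hv⟩
    | frontier j i =>
      obtain ⟨y, hy, -, h⟩ := exists_neighbor hA ht hx (Or.inl hv)
      have h1 := (h hv).rank_lt hy.proper hx.proper
      obtain ⟨S, hS, -⟩ := hy
      have h2 := hD _ (mem_pos.2 ⟨S, hS⟩)
      have : -(D : ℤ) ≤ y.rank := by
        unfold Piece.rank; split_ifs <;> omega
      omega
  | succ n ih =>
    cases hv : x.edge.src with
    | center => exact ⟨[], by simp, by simpa using hx, by simpa using hv⟩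
    | frontier j i =>
      obtain ⟨y, hy, -, h⟩ := exists_neighbor hA ht hx (Or.inl hv)
      have h1 := (h hv).rank_lt hy.proper hx.proper
      obtain ⟨l, hl, hm, hlast⟩ := ih hy (by push_cast at hn; omega)
      refine ⟨l ++ [y], ?_, ?_, ?_⟩
      · rw [List.append_assoc, List.singleton_append, List.isChain_append_cons_cons]
        exact ⟨hl, h hv, List.isChain_singleton _⟩
      · intro w hw
        rcases List.mem_append.1 hw with hw | hw
        · exact hm w hw
        · rw [List.mem_singleton.1 hw]; exact hx
      · rw [List.head_append_of_ne_nil (by simp)]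
        exact hlast

/-- Each piece of a unit decomposition belongs to a sliced edge sequence. -/
theorem exists_edgeSequence {A : Set Slice} (hA : t.Over A) (ht : t.IsUnitDecomposition)
    {x : Piece} (hx : t.HasPiece x) : ∃ K : t.EdgeSequence, x ∈ K.pieces := by
  obtain ⟨l, hl, hm, hlast⟩ := exists_forward hA ht hx
  obtain ⟨l', hl', hm', hhead⟩ := exists_backward hA ht hx
  refine ⟨⟨l' ++ x :: l, by simp, ?_, ?_, ?_, List.isChain_split.2 ⟨hl', hl⟩⟩, by simp⟩
  · intro w hw
    rcases List.mem_append.1 hw with hw | hw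
    · exact hm' w (List.mem_append_left _ hw)
    · exact hm w hw
  · cases l' <;> simpa using hhead
  · rw [List.getLast_append_of_ne_nil _ (by simp)]
    exact hlast

end SliceTerm

end SliceCount

/-! ### Isomorphisms, simple paths and zig-zag numbers -/

namespace SliceCount

namespace LabeledDigraph

/-- A bijection of the edges that is compatible with a bijection of the vertices. -/
def Iso.ofEquiv {G H : LabeledDigraph} (f : G.V ≃ H.V) (g : G.E ≃ H.E)
    (hv : ∀ v, G.vertexLabel v = H.vertexLabel (f v))
    (hs : ∀ e, H.src (g e) = f (G.src e)) (ht : ∀ e, H.tgt (g e) = f (G.tgt e))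
    (hl : ∀ e, H.edgeLabel (g e) = G.edgeLabel e) : G.Iso H where
  toEquiv := f
  vertexLabel_eq := hv
  edges_eq v w b := by
    rw [← g.injective.encard_image (G.edgesBetween v w b)]
    congr 1
    ext e
    rw [g.image_eq_preimage_symm]
    obtain ⟨e, rfl⟩ := g.surjective e
    simp [edgesBetween, hs, ht, hl]

def Iso.symm {G H : LabeledDigraph} (φ : G.Iso H) : H.Iso G where
  toEquiv := φ.toEquiv.symm
  vertexLabel_eq v := by simp [φ.vertexLabel_eq]
  edges_eq v w b := by simp [φ.edges_eq]

def Iso.trans {G H K : LabeledDigraph} (φ : G.Iso H) (ψ : H.Iso K) : G.Iso K where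
  toEquiv := φ.toEquiv.trans ψ.toEquiv
  vertexLabel_eq v := by simp [φ.vertexLabel_eq, ψ.vertexLabel_eq]
  edges_eq v w b := by simp [φ.edges_eq, ψ.edges_eq]

theorem SimplePath.eq_of_src_eq {G : LabeledDigraph} (P : G.SimplePath) {e e' : G.E}
    (he : e ∈ P.edges) (he' : e' ∈ P.edges) (h : G.src e = G.src e') : e = e' := by
  obtain ⟨i, hi, rfl⟩ := List.getElem_of_mem he
  obtain ⟨i', hi', rfl⟩ := List.getElem_of_mem he'
  rw [P.src_eq i hi, P.src_eq i' hi'] at h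
  have := (P.nodup.getElem_inj_iff).1 h
  subst this
  rfl

theorem SimplePath.src_ne_tgt {G : LabeledDigraph} (P : G.SimplePath) {e : G.E}
    (he : e ∈ P.edges) : G.src e ≠ G.tgt e := by
  obtain ⟨i, hi, rfl⟩ := List.getElem_of_mem he
  rw [P.src_eq i hi, P.tgt_eq i hi]
  intro h
  have := (P.nodup.getElem_inj_iff).1 h
  omega

/-- The image of a simple path under an injective morphism. -/
def SimplePath.map {G H : LabeledDigraph} (P : G.SimplePath) {f : G.V → H.V}
    (hf : Function.Injective f) (g : G.E → H.E) (hs : ∀ e, H.src (g e) = f (G.src e))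
    (ht : ∀ e, H.tgt (g e) = f (G.tgt e)) : H.SimplePath where
  verts := P.verts.map f
  edges := P.edges.map g
  length_eq := by simp [P.length_eq]
  nodup := P.nodup.map hf
  src_eq i h := by
    simp only [List.length_map] at h
    simp [hs, P.src_eq i h]
  tgt_eq i h := by
    simp only [List.length_map] at h
    simp [ht, P.tgt_eq i h]

/-- The edge map `g` may fail to be injective on the digraph, but the edges of a simple path have
distinct sources, so it is injective on them. -/
theorem SimplePath.encard_cut_le_map {G H : LabeledDigraph} (P : G.SimplePath) {f : G.V → H.V}
    (hf : Function.Injective f) (g : G.E → H.E) (hs : ∀ e, H.src (g e) = f (G.src e))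
    (ht : ∀ e, H.tgt (g e) = f (G.tgt e)) {X : Set G.V} {Y : Set H.V}
    (hXY : ∀ v, f v ∈ Y ↔ v ∈ X) :
    ({e | e ∈ P.edges} ∩ G.cut X).encard ≤
      ({e | e ∈ (P.map hf g hs ht).edges} ∩ H.cut Y).encard := by
  have hinj : Set.InjOn g ({e | e ∈ P.edges} ∩ G.cut X) := by
    intro e he e' he' h
    exact P.eq_of_src_eq he.1 he'.1 (hf (by rw [← hs, ← hs, h]))
  rw [← hinj.encard_image]
  refine Set.encard_le_encard ?_
  rintro _ ⟨e, ⟨he, hc⟩, rfl⟩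
  refine ⟨List.mem_map_of_mem he, ?_⟩
  simpa [cut, hs, ht, hXY] using hc

end LabeledDigraph

namespace SliceTerm

open LabeledDigraph

/-- Simple paths of the digraph of `t` cross the cut of a position at most `z` times. -/
def ZigZagLE (t : SliceTerm) (z : ℕ) : Prop :=
  ∀ (P : t.toDigraph.SimplePath) (p : List ℕ), p ∈ t.pos →
    ({e | e ∈ P.edges} ∩ t.toDigraph.cut {v | p <+: v.1}).encard ≤ z

/-- An isomorphism only matches numbers of edges, so for each edge of `t.toDigraph` some edge of `G`
with corresponding endpoints is chosen. This need not be a bijection; it suffices for transporting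
one simple path together with its cuts. -/
theorem TreeZigZagLE.zigZagLE {t : SliceTerm} {z : ℕ} (h : t.TreeZigZagLE z) : t.ZigZagLE z := by
  obtain ⟨G, D, ⟨hpos, φ, hφ⟩, hz⟩ := h
  intro P p hp
  have hex : ∀ e : t.toDigraph.E, ∃ e' : G.E, G.src e' = φ.toEquiv.symm (t.toDigraph.src e) ∧
      G.tgt e' = φ.toEquiv.symm (t.toDigraph.tgt e) := by
    intro e
    have h1 := φ.edges_eq (φ.toEquiv.symm (t.toDigraph.src e))
      (φ.toEquiv.symm (t.toDigraph.tgt e)) (t.toDigraph.edgeLabel e)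
    rw [φ.toEquiv.apply_symm_apply, φ.toEquiv.apply_symm_apply] at h1
    have h2 : (t.toDigraph.edgesBetween (t.toDigraph.src e) (t.toDigraph.tgt e)
        (t.toDigraph.edgeLabel e)).Nonempty := ⟨e, rfl, rfl, rfl⟩
    rw [← Set.encard_ne_zero, ← h1, Set.encard_ne_zero] at h2
    obtain ⟨e', h3, h4, -⟩ := h2
    exact ⟨e', h3, h4⟩
  choose g hs ht using hex
  have h1 := P.encard_cut_le_map φ.toEquiv.symm.injective g hs ht
    (X := {v | p <+: v.1}) (Y := D.below p) ?_
  · refine h1.trans (le_trans ?_ hz)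
    exact le_iSup_of_le _ (le_iSup_of_le p (le_iSup_of_le (hpos ▸ hp) le_rfl))
  · intro v
    simp only [OliveTree.below, Set.mem_ofPred_eq]
    rw [← hφ, φ.toEquiv.apply_symm_apply]

theorem centerAt_mem_pos {t : SliceTerm} {p : List ℕ} (h : (t.centerAt p).isSome) :
    p ∈ t.pos := by
  rw [mem_pos]
  cases hp : t.get? p with
  | none => simp [centerAt, hp] at h
  | some S => exact ⟨S, rfl⟩

/-- The witness is the digraph of `t` itself, with each vertex placed at its own position. -/
theorem ZigZagLE.treeZigZagLE {t : SliceTerm} {z : ℕ} (h : t.ZigZagLE z) : t.TreeZigZagLE z := by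
  refine ⟨t.toDigraph,
    { nodes := t.pos
      root_mem := mem_pos.2 ⟨_, get?_nil t⟩
      digits := fun p hp => digits_of_mem_pos hp
      prefix_closed := fun p j hp => by
        obtain ⟨S, hS⟩ := mem_pos.1 hp
        exact mem_pos.2 (get?_append_singleton hS).1
      well_numbered := fun p => well_numbered_pos
      map := fun v => v.1
      map_mem := fun v => centerAt_mem_pos v.2
      map_injective := Subtype.val_injective },
    ⟨rfl, Iso.ofEquiv (Equiv.refl _) (Equiv.refl _) (fun _ => rfl) (fun _ => rfl) (fun _ => rfl)
      (fun _ => rfl), fun _ => rfl⟩, ?_⟩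
  exact iSup_le fun P => iSup_le fun p => iSup_le fun hp => h P p hp

/-! ### Subgraphs and subterms -/

theorem IsSub.centerAt {t' t : SliceTerm} (h : IsSub t' t) {p : List ℕ}
    (hp : (t'.centerAt p).isSome) : t'.centerAt p = t.centerAt p := by
  rcases h.get? p with h | ⟨S', S, h1, h2, h3⟩
  · simp [SliceTerm.centerAt, h.1] at hp
  · simp only [SliceTerm.centerAt, h1, h2, Option.bind_some] at hp ⊢
    rcases h3.2.1 with h | h
    · simp [h] at hp
    · exact h

theorem IsSub.hasPiece {t' t : SliceTerm} (h : IsSub t' t) {x : Piece} (hx : t'.HasPiece x) :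
    t.HasPiece x := by
  obtain ⟨S', hS', he⟩ := hx
  obtain ⟨S, hS, hs⟩ := h.get?_some hS'
  exact ⟨S, hS, hs.2.2 he⟩

theorem IsSub.mem_pos {t' t : SliceTerm} (h : IsSub t' t) {p : List ℕ} :
    p ∈ t'.pos ↔ p ∈ t.pos := by
  rw [SliceTerm.mem_pos, SliceTerm.mem_pos]
  rcases h.get? p with h | ⟨S', S, h1, h2, -⟩
  · simp [h.1, h.2]
  · simp [h1, h2]

/-- A sliced edge sequence of a subterm, as a sliced edge sequence of the term. -/
def IsSub.edge {t' t : SliceTerm} (h : IsSub t' t) (K : t'.EdgeSequence) : t.EdgeSequence where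
  pieces := K.pieces
  ne_nil := K.ne_nil
  edge_mem x hx := h.hasPiece (K.edge_mem x hx)
  src_center := K.src_center
  tgt_center := K.tgt_center
  chain := K.chain

/-- A vertex of a subterm, as a vertex of the term. -/
def IsSub.vertex {t' t : SliceTerm} (h : IsSub t' t) (v : t'.toDigraph.V) : t.toDigraph.V :=
  ⟨v.1, h.centerAt v.2 ▸ v.2⟩

theorem IsSub.vertex_injective {t' t : SliceTerm} (h : IsSub t' t) :
    Function.Injective h.vertex := by
  intro v w hvw
  exact Subtype.ext (congrArg (fun u => u.1) hvw)

theorem IsSub.zigZagLE {t' t : SliceTerm} (h : IsSub t' t) {z : ℕ} (ht : t.ZigZagLE z) :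
    t'.ZigZagLE z := by
  intro P p hp
  exact (P.encard_cut_le_map h.vertex_injective h.edge (fun _ => rfl) (fun _ => rfl)
    (Y := {v | p <+: v.1}) (fun v => Iff.rfl)).trans (ht _ p (h.mem_pos.1 hp))

/-- The subgraph represented by a subterm. -/
def IsSub.toSub {t' t : SliceTerm} (_ : IsSub t' t) : t.toDigraph.Sub where
  verts := {v | (t'.centerAt v.1).isSome}
  edges := {K : t.EdgeSequence | ∀ x ∈ K.pieces, t'.HasPiece x}
  src_mem K hK := centerAt_isSome_of_incident (hK _ (List.head_mem _)) (Or.inl K.src_center)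
  tgt_mem K hK := centerAt_isSome_of_incident (hK _ (List.getLast_mem _)) (Or.inr K.tgt_center)

theorem IsSub.iso_toSub {t' t : SliceTerm} (h : IsSub t' t) :
    Nonempty (t'.toDigraph.Iso h.toSub.toDigraph) := by
  refine ⟨Iso.ofEquiv
    ⟨fun v => ⟨h.vertex v, v.2⟩, fun v => ⟨v.1.1, v.2⟩, fun v => rfl, fun v => rfl⟩
    ⟨fun K => ⟨h.edge K, K.edge_mem⟩,
      fun K => ⟨K.1.pieces, K.1.ne_nil, K.2, K.1.src_center, K.1.tgt_center, K.1.chain⟩,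
      fun K => rfl, fun K => rfl⟩ ?_ (fun _ => rfl) (fun _ => rfl) (fun _ => rfl)⟩
  intro v
  change (t'.centerAt v.1).get v.2 = (t.centerAt v.1).get _
  simp only [h.centerAt v.2]

/-- The subterm that represents a subgraph. -/
noncomputable def ofSub {t : SliceTerm} (H : t.toDigraph.Sub) : SliceTerm :=
  t.restrict (fun p => ∃ v ∈ H.verts, v.1 = p)
    fun p e => ∃ K : t.EdgeSequence, K ∈ H.edges ∧ ⟨p, e⟩ ∈ K.pieces

theorem ofSub_isSub {t : SliceTerm} (H : t.toDigraph.Sub) : IsSub (ofSub H) t :=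
  restrict_isSub _ _ _

theorem EdgeSequence.eq_head {t : SliceTerm} (K : t.EdgeSequence) {x : Piece} (hx : x ∈ K.pieces)
    (h : x.edge.src = .center) : x = K.pieces.head K.ne_nil := by
  obtain ⟨A, B, hK⟩ := List.append_of_mem hx
  rcases List.eq_nil_or_concat A with rfl | ⟨A, y, rfl⟩
  · simp [hK]
  · have hc := K.chain
    simp only [hK, List.concat_eq_append, List.append_assoc, List.cons_append,
      List.nil_append] at hc
    exact absurd (List.isChain_cons_cons.1 hc.right_of_append).1 (not_next_of_src_eq_center h y)

theorem EdgeSequence.eq_getLast {t : SliceTerm} (K : t.EdgeSequence) {x : Piece}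
    (hx : x ∈ K.pieces) (h : x.edge.tgt = .center) : x = K.pieces.getLast K.ne_nil := by
  obtain ⟨A, B, hK⟩ := List.append_of_mem hx
  cases B with
  | nil => simp [hK]
  | cons y B =>
    have hc := K.chain
    rw [hK] at hc
    exact absurd (List.isChain_cons_cons.1 hc.right_of_append).1 (not_next_of_tgt_eq_center h y)

/-- `Slice.restrict` also deletes edges at a deleted center. No piece of an edge of `H` is lost in
this way: only its first piece can start and only its last piece can end at a center, and these
centers are vertices of `H`. -/
theorem hasPiece_ofSub {t : SliceTerm} (H : t.toDigraph.Sub) {x : Piece} :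
    (ofSub H).HasPiece x ↔ ∃ K : t.EdgeSequence, K ∈ H.edges ∧ x ∈ K.pieces := by
  constructor
  · rintro ⟨S, hS, he⟩
    rw [ofSub, get?_restrict, Option.map_eq_some_iff] at hS
    obtain ⟨S₀, hS₀, rfl⟩ := hS
    exact (Slice.mem_restrict.1 he).2.1
  · rintro ⟨K, hK, hx⟩
    obtain ⟨S, hS, he⟩ := K.edge_mem x hx
    have hS' := get?_restrict (fun p => ∃ v ∈ H.verts, v.1 = p)
      (fun p e => ∃ K : t.EdgeSequence, K ∈ H.edges ∧ ⟨p, e⟩ ∈ K.pieces) t x.position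
    rw [hS, Option.map_some] at hS'
    refine ⟨_, hS', Slice.mem_restrict.2 ⟨he, ⟨K, hK, hx⟩, ?_⟩⟩
    rintro (h | h)
    · exact ⟨_, H.src_mem K hK, by rw [K.eq_head hx h]; rfl⟩
    · exact ⟨_, H.tgt_mem K hK, by rw [K.eq_getLast hx h]; rfl⟩

theorem centerAt_ofSub {t : SliceTerm} (H : t.toDigraph.Sub) {p : List ℕ} :
    ((ofSub H).centerAt p).isSome ↔ ∃ v ∈ H.verts, v.1 = p := by
  by_cases hc : ∃ v ∈ H.verts, v.1 = p
  · obtain ⟨v, hv, rfl⟩ := hc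
    have h2 := v.2
    cases hp : t.get? v.1 with
    | none => simp [centerAt, hp] at h2
    | some S =>
      simp only [centerAt, hp, Option.bind_some] at h2
      have h3 : ∃ w ∈ H.verts, w.1 = v.1 := ⟨v, hv, rfl⟩
      simp only [centerAt, ofSub, get?_restrict, hp, Option.map_some, Option.bind_some,
        Slice.restrict, h3]
      simpa using h2
  · refine iff_of_false ?_ hc
    cases hp : t.get? p with
    | none => simp [centerAt, ofSub, get?_restrict, hp]
    | some S =>
      simp only [centerAt, ofSub, get?_restrict, hp, Option.map_some, Option.bind_some,
        Slice.restrict, if_neg hc]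
      simp

/-- No new edges appear by recombining pieces: the first piece of an edge of the subterm belongs to
an edge of `H`, and by `EdgeSequence.eq_of_mem` the two edges coincide. -/
theorem toSub_ofSub {t : SliceTerm} (H : t.toDigraph.Sub) : (ofSub_isSub H).toSub = H := by
  have h1 : (ofSub_isSub H).toSub.verts = H.verts := by
    ext v
    refine (centerAt_ofSub H).trans ⟨?_, fun h => ⟨v, h, rfl⟩⟩
    rintro ⟨w, hw, h⟩
    rwa [← Subtype.ext h]
  have h2 : (ofSub_isSub H).toSub.edges = H.edges := by
    ext K
    constructor
    · intro h
      obtain ⟨K', hK', hx⟩ := (hasPiece_ofSub H).1 (h _ (List.head_mem K.ne_nil))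
      rwa [EdgeSequence.eq_of_mem (List.head_mem K.ne_nil) hx]
    · exact fun h x hx => (hasPiece_ofSub H).2 ⟨K, h, hx⟩
  cases H
  generalize (ofSub_isSub _).toSub = H' at h1 h2
  cases H'
  simp_all

/-- A frontier vertex survives on one side because its edge is a piece of some edge of `H`. That
sliced edge sequence continues across the frontier, so the matching vertex survives on the other
side. -/
theorem isUnitDecomposition_ofSub {t : SliceTerm}
    (ht : t.IsUnitDecomposition) (H : t.toDigraph.Sub) : (ofSub H).IsUnitDecomposition := by
  have hsub := ofSub_isSub H
  refine ⟨fun p j S S' hS hS' => ?_, ?_⟩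
  · obtain ⟨S₀, hS₀, h⟩ := hsub.get?_some hS
    obtain ⟨S₀', hS₀', h'⟩ := hsub.get?_some hS'
    have hg := ht.1 p j S₀ S₀' hS₀ hS₀'
    have hj : j ≠ 0 := by have := hg.1; omega
    refine ⟨⟨hg.1.1, h.1 ▸ hg.1.2⟩, fun i => ?_,
      fun i e he e' he' => hg.2.2 i e (h'.2.2 he) e' (h.2.2 he')⟩
    constructor
    · intro hi
      obtain ⟨e, he, hv⟩ := Slice.mem_frontier.1 hi
      obtain ⟨e', he', hv'⟩ := Slice.mem_frontier.1
        ((hg.2.1 i).1 (Slice.mem_frontier.2 ⟨e, h'.2.2 he, hv⟩))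
      obtain ⟨K, hK, hx⟩ := (hasPiece_ofSub H (x := ⟨p ++ [j], e⟩)).1 ⟨S', hS', he⟩
      have hy : t.HasPiece ⟨p, e'⟩ := ⟨S₀, hS₀, he'⟩
      have hmem : ⟨p, e'⟩ ∈ K.pieces := by
        rcases (hg.2.2 i e (h'.2.2 he) e' he' hv hv').2 with h1 | h1
        · exact K.mem_of_next hx hy ⟨j, i, Or.inl ⟨rfl, h1.1, h1.2⟩⟩
        · exact K.mem_of_prev hx hy ⟨j, i, Or.inr ⟨rfl, h1.2, h1.1⟩⟩
      obtain ⟨S₁, hS₁, he₁⟩ := (hasPiece_ofSub H).2 ⟨K, hK, hmem⟩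
      rw [hS] at hS₁
      cases hS₁
      exact Slice.mem_frontier.2 ⟨e', he₁, hv'⟩
    · intro hi
      obtain ⟨e, he, hv⟩ := Slice.mem_frontier.1 hi
      obtain ⟨e', he', hv'⟩ := Slice.mem_frontier.1
        ((hg.2.1 i).2 (Slice.mem_frontier.2 ⟨e, h.2.2 he, hv⟩))
      obtain ⟨K, hK, hx⟩ := (hasPiece_ofSub H (x := ⟨p, e⟩)).1 ⟨S, hS, he⟩
      have hy : t.HasPiece ⟨p ++ [j], e'⟩ := ⟨S₀', hS₀', he'⟩
      have hmem : ⟨p ++ [j], e'⟩ ∈ K.pieces := by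
        rcases (hg.2.2 i e' he' e (h.2.2 he) hv' hv).2 with h1 | h1
        · exact K.mem_of_prev hx hy ⟨j, i, Or.inl ⟨rfl, h1.1, h1.2⟩⟩
        · exact K.mem_of_next hx hy ⟨j, i, Or.inr ⟨rfl, h1.2, h1.1⟩⟩
      obtain ⟨S₁, hS₁, he₁⟩ := (hasPiece_ofSub H).2 ⟨K, hK, hmem⟩
      rw [hS'] at hS₁
      cases hS₁
      exact Slice.mem_frontier.2 ⟨e', he₁, hv'⟩
  · obtain ⟨S, hS, h⟩ := hsub.get?_some (get?_nil _)
    rw [get?_nil, Option.some.injEq] at hS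
    subst hS
    exact Finset.subset_empty.1 (ht.2 ▸ h.frontier_subset 0)

/-- Only pieces that lie on no sliced edge sequence could be lost, and a unit decomposition has
none. -/
theorem IsSub.ofSub_toSub {A : Set Slice} {t' t : SliceTerm} (h : IsSub t' t) (hA : t'.Over A)
    (ht : t'.IsUnitDecomposition) : ofSub h.toSub = t' := by
  refine IsSub.eq_of_get? (ofSub_isSub _) h fun p => ?_
  have hpiece : ∀ x, (ofSub h.toSub).HasPiece x ↔ t'.HasPiece x := by
    intro x
    rw [hasPiece_ofSub]
    constructor
    · rintro ⟨K, hK, hx⟩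
      exact hK x hx
    · intro hx
      obtain ⟨K, hK⟩ := exists_edgeSequence hA ht hx
      exact ⟨h.edge K, K.edge_mem, hK⟩
  have hcenter : ∀ p, ((ofSub h.toSub).centerAt p).isSome ↔ (t'.centerAt p).isSome := by
    intro p
    rw [centerAt_ofSub]
    constructor
    · rintro ⟨v, hv, rfl⟩
      exact hv
    · intro hp
      exact ⟨⟨p, h.centerAt hp ▸ hp⟩, hp, rfl⟩
  rcases (ofSub_isSub h.toSub).get? p with h1 | ⟨S₁, S, h1, h2, h3⟩
  · rcases h.get? p with h2 | ⟨S', S, -, h2, -⟩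
    · rw [h1.1, h2.1]
    · rw [h1.2] at h2
      cases h2
  · rcases h.get? p with h4 | ⟨S', S₀, h4, h5, h6⟩
    · rw [h2] at h4
      cases h4.2
    · rw [h2] at h5
      cases h5
      rw [h1, h4]
      congr 1
      refine Slice.eq_of_fields (h3.1.trans h6.1.symm) ?_ ?_
      · have := hcenter p
        simp only [SliceTerm.centerAt, h1, h4, Option.bind_some] at this
        rcases h3.2.1 with h7 | h7 <;> rcases h6.2.1 with h8 | h8
        · rw [h7, h8]
        · rw [h7] at this ⊢
          cases hc : S'.center with
          | none => rfl
          | some a => simp [hc] at this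
        · rw [h8] at this ⊢
          cases hc : S₁.center with
          | none => rfl
          | some a => simp [hc] at this
        · rw [h7, h8]
      · ext e
        have := hpiece ⟨p, e⟩
        simpa [HasPiece, h1, h4] using this

/-! ### Width and loops -/

/-- The sliced edge sequence through `[0, i]` crosses the cut exactly there. The last clause records
that the direction of the crossing can be read off from the source of `K`; it serves for injectivity
in `card_frontier_zero_le`. -/
theorem exists_mem_cut {A : Set Slice} {t : SliceTerm} (hA : t.Over A)
    (ht : t.IsUnitDecomposition) {p : List ℕ} {S : Slice} (hS : t.get? p = some S) {i : ℕ}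
    (hi : i ∈ S.frontier 0) : ∃ K : t.EdgeSequence, K ∈ t.toDigraph.cut {v | p <+: v.1} ∧
      ∃ e ∈ S.edges, e.Incident (.frontier 0 i) ∧ ⟨p, e⟩ ∈ K.pieces ∧
        (e.tgt = .frontier 0 i ↔ p <+: (t.toDigraph.src K).1) := by
  obtain ⟨e, he, hv⟩ := Slice.mem_frontier.1 hi
  obtain ⟨K, hK⟩ := exists_edgeSequence hA ht (x := ⟨p, e⟩) ⟨S, hS, he⟩
  obtain ⟨B, C, h⟩ := List.append_of_mem hK
  have hP : ∀ w ∈ B ++ ⟨p, e⟩ :: C, w.Proper := fun w hw => (K.hasPiece (h ▸ hw)).proper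
  have hc := K.chain
  rw [h] at hc
  have key : (p <+: (t.toDigraph.src K).1 ∧ ¬ p <+: (t.toDigraph.tgt K).1 ∧
        e.tgt = .frontier 0 i) ∨
      (¬ p <+: (t.toDigraph.src K).1 ∧ p <+: (t.toDigraph.tgt K).1 ∧
        ¬ e.tgt = .frontier 0 i) := by
    have hsrc : (t.toDigraph.src K).1 = (K.pieces.head K.ne_nil).position := rfl
    have htgt : (t.toDigraph.tgt K).1 = (K.pieces.getLast K.ne_nil).position := rfl
    have hs := K.src_center
    have ht := K.tgt_center
    rw [hsrc, htgt]
    rcases hv with hv | hv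
    · right
      obtain ⟨h1, h2⟩ := prefix_iff_of_src hc hP hv
      refine ⟨?_, ?_, fun h => S.not_same_frontier e he 0 i i ⟨hv, h⟩⟩
      · cases B with
        | nil => simp [h, hv] at hs
        | cons b B => simpa [h] using h2 b (by simp)
      · rcases List.eq_nil_or_concat C with rfl | ⟨C, c, rfl⟩
        · simp [h]
        · simpa [h] using h1 c (by simp)
    · left
      obtain ⟨h1, h2⟩ := prefix_iff_of_tgt hc hP hv
      refine ⟨?_, ?_, hv⟩
      · cases B with
        | nil => simp [h]
        | cons b B => simpa [h] using h1 b (by simp)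
      · rcases List.eq_nil_or_concat C with rfl | ⟨C, c, rfl⟩
        · simp [h, hv] at ht
        · simpa [h] using h2 c (by simp)
  refine ⟨K, ?_, e, he, hv, hK, ?_⟩
  · rcases key with h | h
    · exact Or.inl ⟨h.1, h.2.1⟩
    · exact Or.inr ⟨h.1, h.2.1⟩
  · tauto

/-- Distinct frontier vertices lie on distinct crossing edges. If two of them shared an edge `K`,
both pieces would be at `p` and cross in the same direction, hence have the same rank and coincide.
-/
theorem card_frontier_zero_le {A : Set Slice} {t : SliceTerm} (hA : t.Over A)
    (ht : t.IsUnitDecomposition) {p : List ℕ} {S : Slice} (hS : t.get? p = some S) :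
    ((S.frontier 0).card : ℕ∞) ≤ (t.toDigraph.cut {v | p <+: v.1}).encard := by
  rcases (S.frontier 0).eq_empty_or_nonempty with h | ⟨i₀, hi₀⟩
  · simp [h]
  have : Nonempty t.EdgeSequence := ⟨(exists_mem_cut hA ht hS hi₀).choose⟩
  have : Nonempty SliceEdge := ⟨⟨.center, .center, 0⟩⟩
  have hex : ∀ i, i ∈ S.frontier 0 → _ := fun i hi => exists_mem_cut hA ht hS hi
  choose! K hK e he hv hx hd using hex
  rw [← Set.encard_coe_eq_coe_finsetCard]
  refine Set.encard_le_encard_of_injOn (f := K) (fun i hi => hK i hi) ?_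
  intro i hi i' hi' h
  have hx' := hx i' hi'
  have hd' := hd i' hi'
  have hv' := hv i' hi'
  rw [← h] at hx' hd'
  have hprop : ∀ w ∈ (K i).pieces, w.Proper := fun w hw => ((K i).hasPiece hw).proper
  by_cases hs : p <+: (t.toDigraph.src (K i)).1
  · have h1 := (hd i hi).2 hs
    have h2 := hd'.2 hs
    have := eq_of_rank_eq (K i).chain hprop (hx i hi) hx' (by
      rw [Piece.rank, Piece.rank, if_pos ⟨i, h1⟩, if_pos ⟨i', h2⟩])
    simp only [Piece.mk.injEq, true_and] at this
    rw [this, h2] at h1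
    simpa [eq_comm] using h1
  · have h1 : (e i).src = .frontier 0 i := (hv i hi).resolve_right fun h => hs ((hd i hi).1 h)
    have h2 : (e i').src = .frontier 0 i' := hv'.resolve_right fun h => hs (hd'.1 h)
    have := eq_of_rank_eq (K i).chain hprop (hx i hi) hx' (by
      rw [Piece.rank, Piece.rank, if_neg, if_neg]
      · rintro ⟨i'', hi''⟩
        exact S.not_same_frontier _ (he i' hi') 0 i' i'' ⟨h2, hi''⟩
      · rintro ⟨i'', hi''⟩
        exact S.not_same_frontier _ (he i hi) 0 i i'' ⟨h1, hi''⟩)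
    simp only [Piece.mk.injEq, true_and] at this
    rw [this, h2] at h1
    simpa [eq_comm] using h1

/-- For `j = 0` the edges crossing the cut are distributed over `k` paths with at most `z` crossings
each. The other frontiers are matched with the out-frontiers of the children. -/
theorem card_frontier_le {A : Set Slice} {t : SliceTerm} (hA : t.Over A)
    (ht : t.IsUnitDecomposition) {k z : ℕ} (hk : t.toDigraph.IsUnionOfPaths k)
    (hz : t.ZigZagLE z) {p : List ℕ} {S : Slice} (hS : t.get? p = some S) (j : ℕ) :
    (S.frontier j).card ≤ k * z := by
  have h0 : ∀ {p : List ℕ} {S : Slice}, t.get? p = some S → (S.frontier 0).card ≤ k * z := by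
    intro p S hS
    obtain ⟨P, -, hP⟩ := hk
    have h1 : t.toDigraph.cut {v | p <+: v.1} ⊆
        ⋃ i ∈ (Finset.univ : Finset (Fin k)),
          ({e | e ∈ (P i).edges} ∩ t.toDigraph.cut {v | p <+: v.1}) := by
      intro K hK
      obtain ⟨i, hi⟩ := hP K
      simp only [Set.mem_iUnion]
      exact ⟨i, Finset.mem_univ _, hi, hK⟩
    have h2 := (card_frontier_zero_le hA ht hS).trans (Set.encard_le_encard h1)
    have h3 : (⋃ i ∈ (Finset.univ : Finset (Fin k)),
        ({e | e ∈ (P i).edges} ∩ t.toDigraph.cut {v | p <+: v.1})).encard ≤ (k * z : ℕ) := by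
      refine (Finset.set_encard_biUnion_le _ _).trans ?_
      refine (Finset.sum_le_sum fun i _ => hz (P i) p (mem_pos.2 ⟨S, hS⟩)).trans ?_
      simp
    exact_mod_cast h2.trans h3
  rcases Nat.eq_zero_or_pos j with rfl | hj
  · exact h0 hS
  · rcases lt_or_ge S.arity j with h | h
    · simp [Slice.frontier_eq_empty h]
    · obtain ⟨S', hS'⟩ := get?_child hA hS hj h
      have : S.frontier j = S'.frontier 0 := by
        ext i
        exact ((ht.1 _ _ _ _ hS hS').2.1 i).symm
      rw [this]
      exact h0 hS'

/-- A loop at a center is a sliced edge sequence by itself, hence a loop of the digraph, and simple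
paths contain no loops. -/
theorem src_ne_tgt_of_isUnionOfPaths {t : SliceTerm} {k : ℕ}
    (hk : t.toDigraph.IsUnionOfPaths k) {x : Piece} (hx : t.HasPiece x) :
    x.edge.src ≠ x.edge.tgt := by
  intro h
  cases hs : x.edge.src with
  | frontier j i => exact hx.proper.1 j i i ⟨hs, by rw [← h, hs]⟩
  | center =>
    obtain ⟨P, -, hP⟩ := hk
    let K : t.EdgeSequence := ⟨[x], by simp, by simpa [HasPiece] using hx, by simpa using hs,
      by simpa [← h] using hs, List.isChain_singleton _⟩
    obtain ⟨i, hi⟩ := hP K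
    exact (P i).src_ne_tgt hi rfl

end SliceTerm

/-! ### Subgraphs in the graph language correspond to accepted subterms -/

open SliceTerm LabeledDigraph

theorem graphLanguage_of_iso {L : Set SliceTerm} {G H : LabeledDigraph}
    (hH : H ∈ graphLanguage L) (φ : Nonempty (G.Iso H)) : G ∈ graphLanguage L := by
  obtain ⟨t, ht, ⟨ψ⟩⟩ := hH
  exact ⟨t, ht, ⟨φ.some.trans ψ⟩⟩

/-- The subgraphs in the graph language of a saturated set of unit decompositions correspond to the
subterms in the language. -/
theorem card_sub_eq_card_subterm {Γ₁ Γ₂ : Finset ℕ} {q k z : ℕ} {T : SliceTerm}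
    {L : Set SliceTerm} (hT : T.Over (normalizedAlphabet q Γ₁ Γ₂)) (hTu : T.IsUnitDecomposition)
    (hTz : T.TreeZigZagLE z) (hL : ∀ t ∈ L, t.IsUnitDecomposition)
    (hsat : Saturated (sliceAlphabet (k * z) q Γ₁ Γ₂) L z)
    (hk : ∀ H ∈ graphLanguage L, H.IsUnionOfPaths k) :
    Nat.card {H : T.toDigraph.Sub // H.toDigraph ∈ graphLanguage L} =
      Nat.card {t // IsSub t T ∧ t ∈ L} := by
  have hover : ∀ {t}, IsSub t T → t.Over Set.univ := fun h => h.over hT fun _ _ _ => trivial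
  refine Nat.card_congr ⟨fun H => ⟨ofSub H.1, ofSub_isSub H.1, ?_⟩,
    fun t => ⟨t.2.1.toSub, t.1, t.2.2, ⟨t.2.1.iso_toSub.some.symm⟩⟩, ?_, ?_⟩
  · obtain ⟨H, hH⟩ := H
    have hsub := ofSub_isSub H
    have hiso : Nonempty ((ofSub H).toDigraph.Iso H.toDigraph) := by
      have := hsub.iso_toSub
      rwa [toSub_ofSub] at this
    have hu := isUnitDecomposition_ofSub hTu H
    have hz := hsub.zigZagLE hTz.zigZagLE
    have hp := hk _ (graphLanguage_of_iso hH hiso)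
    -- Saturation applies only to terms over the alphabet of width `k * z`. Labels and extra-width
    -- are inherited from `T`, whereas the width bound comes from the covering paths.
    refine hsat _ hH _ (hsub.over hT fun p S hS => ?_) hu hiso hz.treeZigZagLE
    obtain ⟨S₀, hS₀, h⟩ := hsub.get?_some hS
    obtain ⟨⟨h1, -, h3, h4, h5⟩, -⟩ := get?_mem hT hS₀
    refine ⟨h.1 ▸ h1, card_frontier_le (hover hsub) hu hp hz hS,
      fun j i hi => h3 j i (h.frontier_subset j hi), fun a ha => ?_, fun e he => h5 e (h.2.2 he)⟩
    rcases h.2.1 with h6 | h6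
    · simp [h6] at ha
    · exact h4 a (h6 ▸ ha)
  · intro H
    exact Subtype.ext (toSub_ofSub H.1)
  · intro t
    exact Subtype.ext (t.2.1.ofSub_toSub (hover t.2.1) (hL _ t.2.2))

end SliceCount

/-! ### Counting the runs of a deterministic automaton on subterms -/

namespace SliceCount

open SliceTerm

namespace TreeAutomaton

variable {M : TreeAutomaton}

theorem Deterministic.reaches_unique (hM : M.Deterministic) {t : SliceTerm}
    {r r' : Fin M.numStates} (h : M.Reaches t r) (h' : M.Reaches t r') : r = r' := by
  induction t generalizing r r' with
  | nullary S => exact hM _ _ _ _ h h'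
  | unary S t ih =>
    obtain ⟨r₁, h1, h2⟩ := h
    obtain ⟨r₁', h1', h2'⟩ := h'
    obtain rfl := ih h1 h1'
    exact hM _ _ _ _ h2 h2'
  | binary S t₁ t₂ ih₁ ih₂ =>
    obtain ⟨r₁, r₂, h1, h2, h3⟩ := h
    obtain ⟨r₁', r₂', h1', h2', h3'⟩ := h'
    obtain rfl := ih₁ h1 h1'
    obtain rfl := ih₂ h2 h2'
    exact hM _ _ _ _ h3 h3'

open Classical in
/-- The subterms of a term with a run that leads to a given state. -/
noncomputable def runSet (M : TreeAutomaton) : SliceTerm → Fin M.numStates → Finset SliceTerm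
  | nullary S, r => (M.trans.filter fun d => d.2.1.IsSub S ∧ d.2.2 = r).biUnion fun d =>
      match d.1 with
      | [] => {nullary d.2.1}
      | _ => ∅
  | unary S t, r => (M.trans.filter fun d => d.2.1.IsSub S ∧ d.2.2 = r).biUnion fun d =>
      match d.1 with
      | [r₁] => (runSet M t r₁).image (unary d.2.1)
      | _ => ∅
  | binary S t₁ t₂, r => (M.trans.filter fun d => d.2.1.IsSub S ∧ d.2.2 = r).biUnion fun d =>
      match d.1 with
      | [r₁, r₂] => Finset.image₂ (binary d.2.1) (runSet M t₁ r₁) (runSet M t₂ r₂)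
      | _ => ∅

theorem mem_runSet {t' t : SliceTerm} {r : Fin M.numStates} :
    t' ∈ M.runSet t r ↔ t'.IsSub t ∧ M.Reaches t' r := by
  classical
  induction t generalizing t' r with
  | nullary S =>
    simp only [runSet, Finset.mem_biUnion, Finset.mem_filter]
    constructor
    · rintro ⟨⟨qs, S', r'⟩, ⟨hd, hS, rfl⟩, h⟩
      match qs, h with
      | [], h =>
        simp only [Finset.mem_singleton] at h
        subst h
        exact ⟨hS, hd⟩
    · cases t' <;> rintro ⟨h1, h2⟩ <;> simp only [IsSub] at h1
      exact ⟨_, ⟨h2, h1, rfl⟩, by simp⟩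
  | unary S t ih =>
    simp only [runSet, Finset.mem_biUnion, Finset.mem_filter]
    constructor
    · rintro ⟨⟨qs, S', r'⟩, ⟨hd, hS, rfl⟩, h⟩
      match qs, h with
      | [r₁], h =>
        simp only [Finset.mem_image, ih] at h
        obtain ⟨t₁, h1, rfl⟩ := h
        exact ⟨⟨hS, h1.1⟩, r₁, h1.2, hd⟩
    · cases t' <;> rintro ⟨h1, h2⟩ <;> simp only [IsSub] at h1
      obtain ⟨r₁, h3, h4⟩ := h2
      exact ⟨_, ⟨h4, h1.1, rfl⟩, Finset.mem_image_of_mem _ (ih.2 ⟨h1.2, h3⟩)⟩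
  | binary S t₁ t₂ ih₁ ih₂ =>
    simp only [runSet, Finset.mem_biUnion, Finset.mem_filter]
    constructor
    · rintro ⟨⟨qs, S', r'⟩, ⟨hd, hS, rfl⟩, h⟩
      match qs, h with
      | [r₁, r₂], h =>
        simp only [Finset.mem_image₂, ih₁, ih₂] at h
        obtain ⟨t₁, h1, t₂, h2, rfl⟩ := h
        exact ⟨⟨hS, h1.1, h2.1⟩, r₁, r₂, h1.2, h2.2, hd⟩
    · cases t' <;> rintro ⟨h1, h2⟩ <;> simp only [IsSub] at h1
      obtain ⟨r₁, r₂, h3, h4, h5⟩ := h2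
      exact ⟨_, ⟨h5, h1.1, rfl⟩,
        Finset.mem_image₂_of_mem (ih₁.2 ⟨h1.2.1, h3⟩) (ih₂.2 ⟨h1.2.2, h4⟩)⟩

/-- The number of ways to choose subterms below the root that lead to the given states. -/
noncomputable def weight (M : TreeAutomaton) : SliceTerm → List (Fin M.numStates) → ℕ
  | nullary _, [] => 1
  | unary _ t, [r] => (M.runSet t r).card
  | binary _ t₁ t₂, [r₁, r₂] => (M.runSet t₁ r₁).card * (M.runSet t₂ r₂).card
  | _, _ => 0

open Classical in
-- The union over the transitions is disjoint: a subterm determines its root slice and, by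
-- determinism, the states of its children, so the transition at its root is known. For a fixed
-- transition the children are chosen independently.
theorem Deterministic.card_runSet (hM : M.Deterministic) (t : SliceTerm) (r : Fin M.numStates) :
    (M.runSet t r).card =
      ∑ d ∈ M.trans.filter fun d => d.2.1.IsSub t.root ∧ d.2.2 = r, M.weight t d.1 := by
  cases t with
  | nullary S =>
    rw [runSet, Finset.card_biUnion]
    · refine Finset.sum_congr rfl fun ⟨qs, S', r'⟩ hd => ?_
      match qs with
      | [] => simp [weight]
      | _ :: _ => simp [weight]
    · rintro ⟨qs, S', r'⟩ hd ⟨qs₂, S₂, r₂⟩ hd₂ hne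
      rw [Function.onFun, Finset.disjoint_left]
      rintro t' h h₂
      replace hd := Finset.mem_filter.1 (Finset.mem_coe.1 hd)
      replace hd₂ := Finset.mem_filter.1 (Finset.mem_coe.1 hd₂)
      have hr : r' = r₂ := hd.2.2.trans hd₂.2.2.symm
      match qs, h, qs₂, h₂ with
      | [], h, [], h₂ =>
        simp only [Finset.mem_singleton] at h h₂
        rw [h] at h₂
        simp only [nullary.injEq] at h₂
        exact hne (by rw [h₂, hr])
  | unary S t =>
    rw [runSet, Finset.card_biUnion]
    · refine Finset.sum_congr rfl fun ⟨qs, S', r'⟩ hd => ?_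
      match qs with
      | [] => simp [weight]
      | [r₁] =>
        simp only [weight]
        exact Finset.card_image_of_injective _ fun a b h => (unary.inj h).2
      | _ :: _ :: _ => simp [weight]
    · rintro ⟨qs, S', r'⟩ hd ⟨qs₂, S₂, r₂⟩ hd₂ hne
      rw [Function.onFun, Finset.disjoint_left]
      rintro t' h h₂
      replace hd := Finset.mem_filter.1 (Finset.mem_coe.1 hd)
      replace hd₂ := Finset.mem_filter.1 (Finset.mem_coe.1 hd₂)
      have hr : r' = r₂ := hd.2.2.trans hd₂.2.2.symm
      match qs, h, qs₂, h₂ with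
      | [r₁], h, [r₁'], h₂ =>
        simp only [Finset.mem_image, mem_runSet] at h h₂
        obtain ⟨t₁, h1, rfl⟩ := h
        obtain ⟨t₁', h1', h⟩ := h₂
        obtain ⟨rfl, rfl⟩ := unary.inj h
        obtain rfl := hM.reaches_unique h1.2 h1'.2
        exact hne (by rw [hr])
  | binary S t₁ t₂ =>
    rw [runSet, Finset.card_biUnion]
    · refine Finset.sum_congr rfl fun ⟨qs, S', r'⟩ hd => ?_
      match qs with
      | [] => simp [weight]
      | [_] => simp [weight]
      | [r₁, r₂] =>
        simp only [weight]
        refine Finset.card_image₂_iff.2 ?_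
        rintro ⟨a, b⟩ - ⟨a', b'⟩ - h
        have := binary.inj h
        exact Prod.ext this.2.1 this.2.2
      | _ :: _ :: _ :: _ => simp [weight]
    · rintro ⟨qs, S', r'⟩ hd ⟨qs₂, S₂, r₂⟩ hd₂ hne
      rw [Function.onFun, Finset.disjoint_left]
      rintro t' h h₂
      replace hd := Finset.mem_filter.1 (Finset.mem_coe.1 hd)
      replace hd₂ := Finset.mem_filter.1 (Finset.mem_coe.1 hd₂)
      have hr : r' = r₂ := hd.2.2.trans hd₂.2.2.symm
      match qs, h, qs₂, h₂ with
      | [r₁, r₂], h, [r₁', r₂'], h₂ =>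
        simp only [Finset.mem_image₂, mem_runSet] at h h₂
        obtain ⟨t₁, h1, t₂, h2, rfl⟩ := h
        obtain ⟨t₁', h1', t₂', h2', h⟩ := h₂
        obtain ⟨rfl, rfl, rfl⟩ := binary.inj h
        obtain rfl := hM.reaches_unique h1.2 h1'.2
        obtain rfl := hM.reaches_unique h2.2 h2'.2
        exact hne (by rw [hr])

open Classical in
theorem Deterministic.sum_card_runSet (hM : M.Deterministic) (t : SliceTerm)
    (s : Finset (Fin M.numStates)) :
    ∑ r ∈ s, (M.runSet t r).card =
      ∑ d ∈ M.trans.filter fun d => d.2.1.IsSub t.root ∧ d.2.2 ∈ s, M.weight t d.1 := by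
  simp_rw [hM.card_runSet]
  refine Eq.trans ?_ (Finset.sum_fiberwise_of_maps_to (t := s) (g := fun d => d.2.2)
    (fun d hd => (Finset.mem_filter.1 hd).2.2) _)
  refine Finset.sum_congr rfl fun r hr => Finset.sum_congr ?_ fun _ _ => rfl
  ext d
  simp only [Finset.mem_filter]
  constructor
  · rintro ⟨h1, h2, rfl⟩
    exact ⟨⟨h1, h2, hr⟩, rfl⟩
  · rintro ⟨⟨h1, h2, -⟩, rfl⟩
    exact ⟨h1, h2, rfl⟩

/-- There is at most one factor `M.trans.card` for the choice of a transition at each position. This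
keeps the number of bits of all intermediate results polynomial. -/
theorem Deterministic.total_le (hM : M.Deterministic) (t : SliceTerm) :
    ∑ r, (M.runSet t r).card ≤ M.trans.card ^ t.size := by
  classical
  have key : ∀ (t : SliceTerm) (b : ℕ), (∀ qs, M.weight t qs ≤ b) →
      ∑ r, (M.runSet t r).card ≤ M.trans.card * b := by
    intro t b hb
    rw [hM.sum_card_runSet]
    refine (Finset.sum_le_card_nsmul _ _ b fun d _ => hb _).trans ?_
    rw [smul_eq_mul]
    exact Nat.mul_le_mul_right _ (Finset.card_filter_le _ _)
  have hsingle : ∀ (t : SliceTerm) r, (M.runSet t r).card ≤ ∑ r, (M.runSet t r).card :=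
    fun t r => Finset.single_le_sum (f := fun r => (M.runSet t r).card)
      (fun _ _ => Nat.zero_le _) (Finset.mem_univ r)
  induction t with
  | nullary S =>
    have := key (nullary S) 1 fun qs => by
      match qs with
      | [] => simp [weight]
      | _ :: _ => simp [weight]
    simpa [size_nullary] using this
  | unary S t ih =>
    rw [size_unary, pow_succ']
    refine key _ _ fun qs => ?_
    match qs with
    | [] => simp [weight]
    | [r] => exact (hsingle t r).trans ih
    | _ :: _ :: _ => simp [weight]
  | binary S t₁ t₂ ih₁ ih₂ =>
    rw [size_binary, pow_succ', pow_add]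
    refine key _ _ fun qs => ?_
    match qs with
    | [] => simp [weight]
    | [_] => simp [weight]
    | [r₁, r₂] => exact Nat.mul_le_mul ((hsingle t₁ r₁).trans ih₁) ((hsingle t₂ r₂).trans ih₂)
    | _ :: _ :: _ :: _ => simp [weight]

theorem Deterministic.card_subterms (hM : M.Deterministic) (t : SliceTerm) :
    Nat.card {t' // IsSub t' t ∧ t' ∈ M.language} = ∑ r ∈ M.final, (M.runSet t r).card := by
  classical
  rw [← Finset.card_biUnion]
  · rw [← Nat.card_eq_finsetCard]
    refine Nat.card_congr (Equiv.subtypeEquivRight fun t' => ?_)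
    simp only [Finset.mem_biUnion, mem_runSet, language, Set.mem_ofPred_eq]
    exact ⟨fun ⟨h1, r, hr, h2⟩ => ⟨r, hr, h1, h2⟩, fun ⟨r, hr, h1, h2⟩ => ⟨h1, r, hr, h2⟩⟩
  · intro r _ r' _ hne
    rw [Function.onFun, Finset.disjoint_left]
    intro t' h h'
    exact hne (hM.reaches_unique (mem_runSet.1 h).2 (mem_runSet.1 h').2)

end TreeAutomaton

end SliceCount

namespace SliceCount

/-! ### Programs with time bounds -/

namespace Prog

/-- With `b` as the body of recursive calls, `p` returns `y` on input `x` within `N` steps. -/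
def Runs (b p : Prog) (x y : SExpr) (N : ℕ) : Prop := ∃ n ≤ N, Eval b p x y n

namespace Runs

variable {b p f g c : Prog} {x y z v : SExpr} {m n N N' : ℕ}

theorem mono (h : Runs b p x y N) (hN : N ≤ N') : Runs b p x y N' := by
  obtain ⟨n, hn, h⟩ := h
  exact ⟨n, hn.trans hN, h⟩

theorem of_eq {y' : SExpr} (h : Runs b p x y N) (hy : y = y') (hN : N ≤ N') :
    Runs b p x y' N' :=
  hy ▸ h.mono hN

theorem id : Runs b .id x x 1 := ⟨1, le_rfl, .id b x⟩

theorem const {d : SExpr} : Runs b (.const d) x d 1 := ⟨1, le_rfl, .const b d x⟩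

theorem fst : Runs b .fst (.cons x y) x 1 := ⟨1, le_rfl, .fst b _⟩

theorem snd : Runs b .snd (.cons x y) y 1 := ⟨1, le_rfl, .snd b _⟩

theorem isAtom_atom {k : ℕ} : Runs b .isAtom (.atom k) (.atom 1) 1 := ⟨1, le_rfl, .isAtom b _⟩

theorem isAtom_cons : Runs b .isAtom (.cons x y) (.atom 0) 1 := ⟨1, le_rfl, .isAtom b _⟩

theorem eqAtom : Runs b .eqAtom x x.eqAtom 1 := ⟨1, le_rfl, .eqAtom b _⟩

theorem pair (hf : Runs b f x y m) (hg : Runs b g x z n) :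
    Runs b (.pair f g) x (.cons y z) (m + n + 1) := by
  obtain ⟨m', hm, hf⟩ := hf
  obtain ⟨n', hn, hg⟩ := hg
  exact ⟨_, by omega, .pair hf hg⟩

theorem comp (hf : Runs b f x y m) (hg : Runs b g y z n) :
    Runs b (.comp g f) x z (m + n + 1) := by
  obtain ⟨m', hm, hf⟩ := hf
  obtain ⟨n', hn, hg⟩ := hg
  exact ⟨_, by omega, .comp hf hg⟩

theorem ite_true (hc : Runs b c x v m) (hv : v ≠ .atom 0) (hf : Runs b f x y n) :
    Runs b (.ite c f g) x y (m + n + 1) := by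
  obtain ⟨m', hm, hc⟩ := hc
  obtain ⟨n', hn, hf⟩ := hf
  exact ⟨_, by omega, .ite_true hc hv hf⟩

theorem ite_false (hc : Runs b c x (.atom 0) m) (hg : Runs b g x y n) :
    Runs b (.ite c f g) x y (m + n + 1) := by
  obtain ⟨m', hm, hc⟩ := hc
  obtain ⟨n', hn, hg⟩ := hg
  exact ⟨_, by omega, .ite_false hc hg⟩

theorem fix (h : Runs f f x y n) : Runs b (.fix f) x y (n + 1) := by
  obtain ⟨n', hn, h⟩ := h
  exact ⟨_, by omega, .fix h⟩

theorem call (h : Runs b b x y n) : Runs b .call x y (n + 1) := by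
  obtain ⟨n', hn, h⟩ := h
  exact ⟨_, by omega, .call h⟩

end Runs

end Prog

namespace SExpr

/-- Truth values. -/
def ofBool (v : Bool) : SExpr := .atom v.toNat

/-- The number of nodes of an S-expression. -/
def nodes : SExpr → ℕ
  | atom _ => 1
  | cons a b => nodes a + nodes b + 1

theorem atom_one_ne_zero : (SExpr.atom 1) ≠ .atom 0 := by simp

end SExpr

open SExpr

namespace Prog.Runs

variable {b f g c : Prog} {x y : SExpr} {m n : ℕ}

theorem ite {v : Bool} (hc : Runs b c x (ofBool v) m) (hf : v = true → Runs b f x y n)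
    (hg : v = false → Runs b g x y n) : Runs b (.ite c f g) x y (m + n + 1) := by
  cases v with
  | true => exact ite_true hc atom_one_ne_zero (hf rfl)
  | false => exact ite_false hc (hg rfl)

end Prog.Runs

open Prog (Runs)

/-! Structural equality -/

def eqBody : Prog :=
  .ite (.comp .isAtom .fst) .eqAtom (.ite (.comp .isAtom .snd) (.const (.atom 0))
    (.ite (.comp .call (.pair (.comp .fst .fst) (.comp .fst .snd)))
      (.comp .call (.pair (.comp .snd .fst) (.comp .snd .snd))) (.const (.atom 0))))

/-- Compares two S-expressions. -/
def eqProg : Prog := .fix eqBody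

/-- The recursion descends in both arguments simultaneously and stops at an atom of either, so the
time does not depend on the size of `y`. -/
theorem runs_eqBody (x y : SExpr) :
    Runs eqBody eqBody (.cons x y) (ofBool (decide (x = y))) (40 * x.nodes) := by
  induction x generalizing y with
  | atom m =>
    refine (Runs.ite_true (Runs.comp .fst .isAtom_atom) atom_one_ne_zero .eqAtom).of_eq ?_
      (by simp [nodes])
    cases y with
    | atom n => by_cases h : m = n <;> simp [SExpr.eqAtom, ofBool, h]
    | cons a b => simp [SExpr.eqAtom, ofBool]
  | cons a b iha ihb =>
    refine (Runs.ite_false (Runs.comp .fst .isAtom_cons) (n := 40 * (a.nodes + b.nodes) + 30)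
      ?_).mono (by simp only [nodes]; omega)
    cases y with
    | atom n =>
      exact (Runs.ite_true (Runs.comp .snd .isAtom_atom) atom_one_ne_zero .const).of_eq
        (by simp [ofBool]) (by omega)
    | cons a' b' =>
      refine (Runs.ite_false (Runs.comp .snd .isAtom_cons) (Runs.ite (Runs.comp
        (Runs.pair (Runs.comp .fst .fst) (Runs.comp .snd .fst)) (Runs.call (iha a')))
        (n := 40 * b.nodes + 9) ?_ ?_)).mono (by omega)
      · intro h
        exact (Runs.comp (Runs.pair (Runs.comp .fst .snd) (Runs.comp .snd .snd))
          (Runs.call (ihb b'))).of_eq (by simp [of_decide_eq_true h]) (by omega)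
      · intro h
        exact Runs.const.of_eq (by simp [ofBool, of_decide_eq_false h]) (by omega)

theorem runs_eqProg {b : Prog} (x y : SExpr) :
    Runs b eqProg (.cons x y) (ofBool (decide (x = y))) (40 * x.nodes + 1) :=
  .fix (runs_eqBody x y)

/-! Recursion on lists -/

def foldBody (z s : Prog) : Prog :=
  .ite (.comp .isAtom .snd) (.comp z .fst)
    (.comp s (.pair .fst (.pair .snd (.comp .call (.pair .fst (.comp .snd .snd))))))

/-- On input `(c, l)`, primitive recursion on the list `l` with parameter `c`: the value at `[]` is
given by `z` on `c`, and the value at a nonempty list `l` by `s` on `(c, (l, y))`, where `y` is the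
value at the tail of `l`. -/
def foldProg (z s : Prog) : Prog := .fix (foldBody z s)

/-- The step is required on suffixes of `l` only, so that it may use facts about members of `l` and
bounds on partial results. Both `z` and `s` must run with any body `b`, because inside `.fix` a call
refers to the fold. -/
theorem runs_foldProg {α : Type*} {enc : α → SExpr} {z s : Prog} {c : SExpr}
    (F : List α → SExpr) {Nz Ns : ℕ} (l : List α) (hz : ∀ b, Runs b z c (F []) Nz)
    (hs : ∀ a l', (a :: l') <:+ l → ∀ b,
      Runs b s (.cons c (.cons (.cons (enc a) (ofList (l'.map enc))) (F l'))) (F (a :: l')) Ns)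
    (b : Prog) :
    Runs b (foldProg z s) (.cons c (ofList (l.map enc))) (F l)
      (l.length * (Ns + 20) + Nz + 20) := by
  suffices h : ∀ l', l' <:+ l → Runs (foldBody z s) (foldBody z s)
      (.cons c (ofList (l'.map enc))) (F l') (l'.length * (Ns + 20) + Nz + 10) from
    (Runs.fix (h l List.suffix_rfl)).mono (by omega)
  intro l' hl'
  induction l' with
  | nil =>
    exact (Runs.ite_true (Runs.comp .snd .isAtom_atom) atom_one_ne_zero
      (Runs.comp .fst (hz _))).mono (by simp; omega)
  | cons a l' ih =>
    have h1 := ih ((List.suffix_cons a l').trans hl')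
    refine (Runs.ite_false (Runs.comp .snd .isAtom_cons) (Runs.comp (Runs.pair .fst (Runs.pair .snd
      (Runs.comp (Runs.pair .fst (Runs.comp .snd .snd)) (Runs.call h1)))) (hs a l' hl' _))).mono ?_
    rw [List.length_cons, Nat.succ_mul]
    omega

/-! Membership and inclusion -/

/-- On input `(a, l)`, whether `a` belongs to the list `l`. -/
def memProg : Prog :=
  foldProg (.const (.atom 0))
    (.ite (.comp eqProg (.pair .fst (.comp .fst (.comp .fst .snd)))) (.const (.atom 1))
      (.comp .snd .snd))

theorem runs_memProg {α : Type*} [DecidableEq α] {enc : α → SExpr}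
    (henc : Function.Injective enc) {N : ℕ} (a : α) (ha : (enc a).nodes ≤ N) (l : List α)
    (b : Prog) :
    Runs b memProg (.cons (enc a) (ofList (l.map enc))) (ofBool (decide (a ∈ l)))
      (l.length * (40 * N + 40) + 30) := by
  refine (runs_foldProg (Ns := 40 * N + 20) (fun l => ofBool (decide (a ∈ l))) l
    (fun b => Runs.const) ?_ b).mono (by linarith)
  intro a' l' _ b
  refine (Runs.ite (n := 3)
    (Runs.comp (Runs.pair .fst (Runs.comp (Runs.comp .snd .fst) .fst)) (runs_eqProg _ _))
    (fun h => ?_) (fun h => ?_)).mono (by omega)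
  · have h := henc (of_decide_eq_true h)
    exact Runs.const.of_eq (by simp [h, ofBool]) (by omega)
  · have h : a ≠ a' := fun h' => of_decide_eq_false h (by rw [h'])
    exact (Runs.comp .snd .snd).of_eq (by simp [h]) le_rfl

/-- On input `(l, l')`, whether each element of `l'` belongs to `l`. -/
def subsetProg : Prog :=
  foldProg (.const (.atom 1))
    (.ite (.comp memProg (.pair (.comp .fst (.comp .fst .snd)) .fst)) (.comp .snd .snd)
      (.const (.atom 0)))

theorem runs_subsetProg {α : Type*} [DecidableEq α] {enc : α → SExpr}
    (henc : Function.Injective enc) {N : ℕ} (hN : ∀ a, (enc a).nodes ≤ N) (l l' : List α)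
    (b : Prog) :
    Runs b subsetProg (.cons (ofList (l.map enc)) (ofList (l'.map enc)))
      (ofBool (decide (∀ a ∈ l', a ∈ l))) (l'.length * (l.length * (40 * N + 40) + 80) + 30) := by
  refine (runs_foldProg (Ns := l.length * (40 * N + 40) + 60)
    (fun l' => ofBool (decide (∀ a ∈ l', a ∈ l))) l'
    (fun b => Runs.const.of_eq (by simp [ofBool]) le_rfl) ?_ b).mono (by linarith)
  intro a l' _ b
  refine (Runs.ite (n := 3)
    (Runs.comp (Runs.pair (Runs.comp (Runs.comp .snd .fst) .fst) .fst)
      (runs_memProg henc a (hN a) l b)) (fun h => ?_) (fun h => ?_)).mono (by omega)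
  · exact (Runs.comp .snd .snd).of_eq (by simp [of_decide_eq_true h]) le_rfl
  · exact Runs.const.of_eq (by simp [of_decide_eq_false h, ofBool]) (by omega)

/-! Binary arithmetic -/

theorem ofNat_zero : ofNat 0 = .atom 0 := by simp [ofNat, ofList]

/-- The hypothesis excludes a leading zero digit, which `Nat.bits` never produces; the arithmetic
programs have to respect this normal form. -/
theorem ofNat_bit (v : Bool) (n : ℕ) (h : n = 0 → v = true) :
    ofNat (Nat.bit v n) = .cons (ofBool v) (ofNat n) := by
  simp [ofNat, Nat.bits_append_bit n v h, ofList, ofBool]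

def succBody : Prog :=
  .ite .isAtom (.const (.cons (.atom 1) (.atom 0)))
    (.ite .fst (.pair (.const (.atom 0)) (.comp .call .snd)) (.pair (.const (.atom 1)) .snd))

/-- The successor of a number. -/
def succProg : Prog := .fix succBody

theorem runs_succProg (n : ℕ) (b : Prog) :
    Runs b succProg (ofNat n) (ofNat (n + 1)) (20 * n.size + 20) := by
  suffices h : Runs succBody succBody (ofNat n) (ofNat (n + 1)) (20 * n.size + 10) from
    (Runs.fix h).mono (by omega)
  induction n using Nat.binaryRec' with
  | zero =>
    rw [ofNat_zero]
    refine (Runs.ite_true .isAtom_atom atom_one_ne_zero .const).of_eq ?_ (by omega)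
    rw [show (0 + 1 : ℕ) = Nat.bit true 0 from rfl, ofNat_bit _ _ (by simp), ofNat_zero]
    rfl
  | bit v n h ih =>
    rw [ofNat_bit v n h, Nat.size_bit (by
      intro h0
      rw [Nat.bit_eq_zero_iff] at h0
      simp [h h0.1] at h0)]
    refine (Runs.ite_false .isAtom_cons (Runs.ite (v := v) .fst (n := 20 * n.size + 15)
      (fun hv => ?_) (fun hv => ?_))).mono (by rw [Nat.succ_eq_add_one]; omega)
    · subst hv
      refine (Runs.pair .const (Runs.comp .snd (Runs.call ih))).of_eq ?_ (by omega)
      rw [show Nat.bit true n + 1 = Nat.bit false (n + 1) by simp [Nat.bit]; ring,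
        ofNat_bit _ _ (by simp)]
      rfl
    · subst hv
      refine (Runs.pair .const .snd).of_eq ?_ (by omega)
      rw [show Nat.bit false n + 1 = Nat.bit true n by simp [Nat.bit], ofNat_bit _ _ (by simp)]
      rfl

def addBody : Prog :=
  .ite (.comp .isAtom .fst) .snd (.ite (.comp .isAtom .snd) .fst
    (.ite (.comp .fst .fst)
      (.ite (.comp .fst .snd)
        (.pair (.const (.atom 0))
          (.comp succProg (.comp .call (.pair (.comp .snd .fst) (.comp .snd .snd)))))
        (.pair (.const (.atom 1)) (.comp .call (.pair (.comp .snd .fst) (.comp .snd .snd)))))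
      (.pair (.comp .fst .snd) (.comp .call (.pair (.comp .snd .fst) (.comp .snd .snd))))))

/-- The sum of two numbers. -/
def addProg : Prog := .fix addBody

/-- No carry is passed along: if both digits are `1`, the sum of the tails is incremented by
`succProg`. This costs linear time per digit, hence quadratic time in all. -/
theorem runs_addProg {B : ℕ} (m n : ℕ) (hB : (m + n).size ≤ B) (b : Prog) :
    Runs b addProg (.cons (ofNat m) (ofNat n)) (ofNat (m + n)) (100 * (B + 1) ^ 2) := by
  suffices h : Runs addBody addBody (.cons (ofNat m) (ofNat n)) (ofNat (m + n))
      (m.size * (20 * B + 80) + 20) by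
    refine (Runs.fix h).mono ?_
    have : m.size ≤ B := (Nat.size_le_size (Nat.le_add_right m n)).trans hB
    nlinarith [Nat.mul_le_mul_right (20 * B + 80) this]
  induction m using Nat.binaryRec' generalizing n with
  | zero =>
    rw [ofNat_zero, zero_add]
    exact (Runs.ite_true (Runs.comp .fst .isAtom_atom) atom_one_ne_zero .snd).mono (by omega)
  | bit v m h ih =>
    rw [ofNat_bit v m h, Nat.size_bit (by
      intro h0
      rw [Nat.bit_eq_zero_iff] at h0
      simp [h h0.1] at h0)]
    refine (Runs.ite_false (Runs.comp .fst .isAtom_cons) (n := m.size * (20 * B + 80) + 20 * B + 80)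
      ?_).mono (by rw [Nat.succ_eq_add_one]; linarith)
    induction n using Nat.binaryRec' with
    | zero =>
      rw [ofNat_zero, add_zero, ofNat_bit v m h]
      exact (Runs.ite_true (Runs.comp .snd .isAtom_atom) atom_one_ne_zero .fst).mono (by omega)
    | bit w n h' _ =>
      rw [ofNat_bit w n h']
      have hle : m + n ≤ Nat.bit v m + Nat.bit w n := by
        simp only [Nat.bit_val]; omega
      have hB' : (m + n).size ≤ B := (Nat.size_le_size hle).trans hB
      have hrec : Runs addBody
          (.comp .call (.pair (.comp .snd .fst) (.comp .snd .snd)))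
          (.cons (.cons (ofBool v) (ofNat m)) (.cons (ofBool w) (ofNat n))) (ofNat (m + n)) _ :=
        Runs.comp (Runs.pair (Runs.comp .fst .snd) (Runs.comp .snd .snd)) (Runs.call (ih n hB'))
      refine (Runs.ite_false (Runs.comp .snd .isAtom_cons) (Runs.ite (v := v)
        (Runs.comp .fst .fst) (n := m.size * (20 * B + 80) + 20 * B + 70)
        (fun hv => ?_) (fun hv => ?_))).mono (by omega)
      · subst hv
        refine (Runs.ite (v := w) (Runs.comp .snd .fst)
          (n := m.size * (20 * B + 80) + 20 * B + 63) (fun hw => ?_) (fun hw => ?_)).mono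
          (by omega)
        · subst hw
          refine (Runs.pair .const (Runs.comp hrec (runs_succProg _ _))).of_eq ?_ (by omega)
          rw [show Nat.bit true m + Nat.bit true n = Nat.bit false (m + n + 1) by
            simp [Nat.bit]; ring, ofNat_bit _ _ (by simp)]
          rfl
        · subst hw
          refine (Runs.pair .const hrec).of_eq ?_ (by omega)
          rw [show Nat.bit true m + Nat.bit false n = Nat.bit true (m + n) by
            simp [Nat.bit]; ring, ofNat_bit _ _ (by simp)]
          rfl
      · subst hv
        refine (Runs.pair (Runs.comp .snd .fst) hrec).of_eq ?_ (by omega)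
        rw [show Nat.bit false m + Nat.bit w n = Nat.bit w (m + n) by
          cases w <;> simp [Nat.bit] <;> ring, ofNat_bit _ _ (by
            intro h0
            exact absurd (h (by omega)) (by simp))]

/-- The number with the given binary digits, least significant digit first. -/
def ofBits (l : List Bool) : ℕ := l.foldr Nat.bit 0

theorem ofBits_bits (n : ℕ) : ofBits n.bits = n := by
  induction n using Nat.binaryRec' with
  | zero => rfl
  | bit v n h ih => rw [Nat.bits_append_bit n v h, ofBits, List.foldr_cons, ← ofBits, ih]

theorem ofBits_le_of_suffix {l l' : List Bool} (h : l' <:+ l) : ofBits l' ≤ ofBits l := by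
  induction l with
  | nil => rw [List.suffix_nil.1 h]
  | cons v l ih =>
    rcases List.suffix_cons_iff.1 h with rfl | h
    · exact le_rfl
    · refine (ih h).trans ?_
      simp only [ofBits, List.foldr_cons, Nat.bit_val]
      omega

/-- The double of a number. -/
def doubleProg : Prog :=
  .ite .isAtom (.const (.atom 0)) (.pair (.const (.atom 0)) .id)

theorem runs_doubleProg (n : ℕ) (b : Prog) : Runs b doubleProg (ofNat n) (ofNat (2 * n)) 5 := by
  induction n using Nat.binaryRec' with
  | zero => exact (Runs.ite_true .isAtom_atom atom_one_ne_zero .const).mono (by omega)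
  | bit v n h _ =>
    have h0 : Nat.bit v n ≠ 0 := by
      intro h0
      rw [Nat.bit_eq_zero_iff] at h0
      simp [h h0.1] at h0
    rw [← Nat.bit_false_apply, ofNat_bit false _ (fun h => absurd h h0), ofNat_bit v n h]
    exact Runs.ite_false .isAtom_cons (Runs.pair .const .id)

/-- The product of two numbers. -/
def mulProg : Prog :=
  foldProg (.const (.atom 0))
    (.ite (.comp .fst (.comp .fst .snd))
      (.comp addProg (.pair .fst (.comp doubleProg (.comp .snd .snd))))
      (.comp doubleProg (.comp .snd .snd)))

/-- Doubling and adding along the digits of `n`: the value at a suffix of the digits is `m` times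
its number, which never exceeds `m * n`. The bound on `n.size` is separate because `m` may be `0`.
-/
theorem runs_mulProg {B : ℕ} (m n : ℕ) (hn : n.size ≤ B) (hB : (m * n).size ≤ B) (b : Prog) :
    Runs b mulProg (.cons (ofNat m) (ofNat n)) (ofNat (m * n)) (200 * (B + 1) ^ 3) := by
  have h := runs_foldProg (enc := fun v : Bool => SExpr.atom v.toNat) (c := ofNat m)
    (z := .const (.atom 0)) (s := .ite (.comp .fst (.comp .fst .snd))
      (.comp addProg (.pair .fst (.comp doubleProg (.comp .snd .snd))))
      (.comp doubleProg (.comp .snd .snd)))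
    (fun l => ofNat (m * ofBits l)) (Ns := 100 * (B + 1) ^ 2 + 40) n.bits
    (fun b => Runs.const.of_eq (by simp [ofBits, ofNat_zero]) le_rfl) ?_ b
  · refine h.of_eq (by rw [ofBits_bits]) ?_
    rw [← Nat.size_eq_bits_len] at hn
    have := Nat.mul_le_mul_right (100 * (B + 1) ^ 2 + 40 + 20) hn
    nlinarith [sq_nonneg B]
  · intro v l hl b
    have hd := runs_doubleProg (m * ofBits l) b
    have hval : ∀ v, ofBits (v :: l) = 2 * ofBits l + v.toNat := fun v => by
      simp [ofBits, Nat.bit_val]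
    refine (Runs.ite (v := v) (Runs.comp (Runs.comp .snd .fst) .fst)
      (n := 100 * (B + 1) ^ 2 + 15) (fun hv => ?_) (fun hv => ?_)).mono (by omega)
    · subst hv
      have e : m + 2 * (m * ofBits l) = m * ofBits (true :: l) := by rw [hval]; simp; ring
      refine (Runs.comp (Runs.pair .fst (Runs.comp (Runs.comp .snd .snd) hd))
        (runs_addProg (B := B) m _ ?_ b)).of_eq ?_ (by omega)
      · rw [e]
        refine (Nat.size_le_size (Nat.mul_le_mul_left m (ofBits_le_of_suffix hl))).trans ?_
        rwa [ofBits_bits]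
      · rw [e]
    · subst hv
      refine (Runs.comp (Runs.comp .snd .snd) hd).of_eq ?_ (by omega)
      rw [hval]
      simp
      ring_nf

end SliceCount

namespace SliceCount

open SExpr SliceTerm

open Prog (Runs)

/-! ### The counting program -/

/-- Conjunction; the second program runs only if the first one returns true. -/
def andProg (p p' : Prog) : Prog := .ite p p' (.const (.atom 0))

theorem runs_andProg {b p p' : Prog} {x : SExpr} {u v : Bool} {m n : ℕ}
    (h : Runs b p x (ofBool u) m) (h' : Runs b p' x (ofBool v) n) :
    Runs b (andProg p p') x (ofBool (u && v)) (m + n + 2) := by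
  cases u with
  | true => exact (Runs.ite_true h atom_one_ne_zero h').mono (by omega)
  | false => exact (Runs.ite_false h .const).mono (by omega)

theorem code_vertex_injective : Function.Injective SliceVertex.code := by
  intro v w h
  cases v <;> cases w <;> simp_all [SliceVertex.code]

theorem code_edge_injective : Function.Injective SliceEdge.code := by
  rintro ⟨s, t, l⟩ ⟨s', t', l'⟩ h
  simp only [SliceEdge.code, SExpr.cons.injEq, SExpr.atom.injEq] at h
  rw [code_vertex_injective h.1, code_vertex_injective h.2.1, h.2.2]

theorem nodes_code_vertex_le (v : SliceVertex) : v.code.nodes ≤ 3 := by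
  cases v <;> simp [SliceVertex.code, nodes]

theorem nodes_code_edge_le (e : SliceEdge) : e.code.nodes ≤ 9 := by
  have h1 := nodes_code_vertex_le e.src
  have h2 := nodes_code_vertex_le e.tgt
  simp only [SliceEdge.code, nodes]
  omega

theorem centerCode_injective : Function.Injective centerCode := by
  intro a b h
  cases a <;> cases b <;> simp_all [centerCode]

/-- On input `(c, c')`, where `c` and `c'` encode optional center vertices, whether `c'` is absent
or equal to `c`. -/
def centerProg : Prog :=
  .ite (.comp .isAtom .snd) (.const (.atom 1)) eqProg

theorem runs_centerProg (a a' : Option ℕ) (b : Prog) :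
    Runs b centerProg (.cons (centerCode a) (centerCode a'))
      (ofBool (decide (a' = none ∨ a' = a))) 140 := by
  cases a' with
  | none =>
    exact (Runs.ite_true (Runs.comp .snd .isAtom_atom) atom_one_ne_zero .const).of_eq
      (by simp [ofBool]) (by omega)
  | some k =>
    refine (Runs.ite_false (Runs.comp .snd .isAtom_cons) (runs_eqProg _ _)).of_eq ?_ ?_
    · congr 1
      rw [decide_eq_decide]
      constructor
      · intro h
        exact Or.inr (centerCode_injective (a₂ := some k) h).symm
      · rintro (h | rfl)
        · simp at h
        · rfl
    · cases a <;> simp [centerCode, nodes]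

namespace Slice

/-- `S'` is a subslice of `S` without loops. -/
def IsLooplessSub (S' S : Slice) : Prop := (∀ e ∈ S'.edges, e.src ≠ e.tgt) ∧ S'.IsSub S

/-- The number of edges that are not loops. -/
def numNonloops (S : Slice) : ℕ := (S.edges.filter fun e => e.src ≠ e.tgt).card

end Slice

theorem Enumerates.length_eq {α : Type} {l : List α} {s : Finset α} (h : Enumerates l s) :
    l.length = s.card := by
  classical
  rw [← List.toFinset_card_of_nodup h.1]
  congr 1
  ext a
  simp [h.2]

/-- On input two slices, whether the second one is a subslice of the first one without loops. -/
def matchProg : Prog :=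
  andProg (.comp .isAtom (.comp .snd (.comp .snd (.comp .snd .snd))))
    (andProg (.comp eqProg (.pair (.comp .fst .snd) (.comp .fst .fst)))
      (andProg (.comp centerProg
          (.pair (.comp .fst (.comp .snd .fst)) (.comp .fst (.comp .snd .snd))))
        (.comp subsetProg (.pair (.comp .fst (.comp .snd (.comp .snd .fst)))
          (.comp .fst (.comp .snd (.comp .snd .snd)))))))

/-- The list of loops of `S` is never read, and that of `S'` is only tested for emptiness. Hence the
time depends on the edges that are not loops alone. -/
theorem runs_matchProg {d d' : SExpr} {S S' : Slice} (hd : Slice.Presents d S)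
    (hd' : Slice.Presents d' S') {v : Bool} (hv : v = true ↔ S'.IsLooplessSub S) (b : Prog) :
    Runs b matchProg (.cons d d') (ofBool v)
      (S'.numNonloops * (S.numNonloops * 400 + 80) + 400) := by
  obtain ⟨l₁, l₂, h1, h2, rfl⟩ := hd
  obtain ⟨l₁', l₂', h1', h2', rfl⟩ := hd'
  rw [Slice.numNonloops, Slice.numNonloops, ← h1.length_eq, ← h1'.length_eq]
  have hl : Runs b .isAtom (ofList (l₂'.map SliceEdge.code)) (ofBool (decide (l₂' = []))) 1 := by
    cases l₂' with
    | nil => exact Runs.isAtom_atom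
    | cons => exact Runs.isAtom_cons
  refine (runs_andProg (Runs.comp (Runs.comp (Runs.comp (Runs.comp .snd .snd) .snd) .snd) hl)
    (runs_andProg (Runs.comp (Runs.pair (Runs.comp .snd .fst) (Runs.comp .fst .fst))
        (runs_eqProg _ _))
      (runs_andProg (Runs.comp (Runs.pair (Runs.comp (Runs.comp .fst .snd) .fst)
          (Runs.comp (Runs.comp .snd .snd) .fst)) (runs_centerProg _ _ _))
        (Runs.comp (Runs.pair (Runs.comp (Runs.comp (Runs.comp .fst .snd) .snd) .fst)
          (Runs.comp (Runs.comp (Runs.comp .snd .snd) .snd) .fst))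
          (runs_subsetProg code_edge_injective nodes_code_edge_le _ _ _))))).of_eq ?_ ?_
  · congr 1
    rw [Bool.eq_iff_iff, hv]
    simp only [Bool.and_eq_true, decide_eq_true_eq, SExpr.atom.injEq, Slice.IsLooplessSub,
      Slice.IsSub]
    have hloop : l₂' = [] ↔ ∀ e ∈ S'.edges, e.src ≠ e.tgt := by
      rw [List.eq_nil_iff_forall_not_mem]
      simp only [h2'.2, Finset.mem_filter, not_and]
    rw [hloop]
    refine and_congr_right fun hno => and_congr_right fun _ => and_congr_right fun _ => ?_
    constructor
    · intro h e he
      have := h e ((h1'.2 e).2 (Finset.mem_filter.2 ⟨he, hno e he⟩))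
      exact (Finset.mem_filter.1 ((h1.2 e).1 this)).1
    · intro h e he
      have he' := Finset.mem_filter.1 ((h1'.2 e).1 he)
      exact (h1.2 e).2 (Finset.mem_filter.2 ⟨h he'.1, he'.2⟩)
  · simp only [nodes]
    linarith

/-! ### Sums and products over tables of states -/

section Tables

variable {n : ℕ}

/-- A state together with a number. -/
def entryCode (a : Fin n × ℕ) : SExpr := .cons (stateCode a.1) (ofNat a.2)

def tableCode (l : List (Fin n × ℕ)) : SExpr := ofList (l.map entryCode)

/-- The sum of the numbers in the table `l` at the states in `s`. -/
def sumOn (s : List (Fin n)) (l : List (Fin n × ℕ)) : ℕ :=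
  ((l.filter fun a => decide (a.1 ∈ s)).map Prod.snd).sum

theorem stateCode_injective : Function.Injective (stateCode (n := n)) := by
  intro r r' h
  simpa [stateCode, Fin.ext_iff] using h

/-- On input a list of states and a table, the sum of the numbers at these states. -/
def sumProg : Prog :=
  foldProg (.const (.atom 0))
    (.ite (.comp memProg (.pair (.comp .fst (.comp .fst (.comp .fst .snd))) .fst))
      (.comp addProg (.pair (.comp .snd (.comp .fst (.comp .fst .snd))) (.comp .snd .snd)))
      (.comp .snd .snd))

theorem runs_sumProg {B : ℕ} (s : List (Fin n)) (l : List (Fin n × ℕ))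
    (hB : (sumOn s l).size ≤ B) (b : Prog) :
    Runs b sumProg (.cons (ofList (s.map stateCode)) (tableCode l)) (ofNat (sumOn s l))
      (l.length * (s.length * 80 + 100 * (B + 1) ^ 2 + 100) + 30) := by
  refine (runs_foldProg (Ns := s.length * 80 + 100 * (B + 1) ^ 2 + 80)
    (fun l => ofNat (sumOn s l)) l (fun b => Runs.const.of_eq (by simp [sumOn, ofNat_zero]) le_rfl)
    ?_ b).mono (by linarith)
  intro a l' hl' b
  -- Partial sums are bounded by the total, so `B` bounds the bits of every intermediate result.
  have hsum : sumOn s (a :: l') ≤ sumOn s l := by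
    obtain ⟨l₀, rfl⟩ := hl'
    simp [sumOn, List.filter_append]
  refine (Runs.ite (Runs.comp (Runs.pair
    (Runs.comp (Runs.comp (Runs.comp .snd .fst) .fst) .fst) .fst)
    (runs_memProg stateCode_injective a.1 (N := 1) (by simp [stateCode, nodes]) s b))
    (n := 100 * (B + 1) ^ 2 + 20) (fun h => ?_) (fun h => ?_)).mono (by omega)
  · have e : sumOn s (a :: l') = a.2 + sumOn s l' := by
      simp only [sumOn, List.filter_cons, h, if_true, List.map_cons, List.sum_cons]
    rw [e]
    exact (Runs.comp (Runs.pair (Runs.comp (Runs.comp (Runs.comp .snd .fst) .fst) .snd)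
      (Runs.comp .snd .snd)) (runs_addProg (B := B) _ _
        ((Nat.size_le_size (e ▸ hsum)).trans hB) b)).mono (by omega)
  · have e : sumOn s (a :: l') = sumOn s l' := by
      simp only [sumOn, List.filter_cons, h]
      simp
    rw [e]
    exact (Runs.comp .snd .snd).mono (by omega)

/-- On input a list of at most two states and as many tables, the product of the sums at the states
in the tables. -/
def productProg : Prog :=
  .ite (.comp .isAtom .snd) (.const (ofNat 1))
    (.ite (.comp .isAtom (.comp .snd .snd))
      (.comp sumProg (.pair (.pair (.comp .fst .fst) (.const (.atom 0))) (.comp .fst .snd)))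
      (.comp mulProg (.pair
        (.comp sumProg (.pair (.pair (.comp .fst .fst) (.const (.atom 0))) (.comp .fst .snd)))
        (.comp sumProg (.pair (.pair (.comp .fst (.comp .snd .fst)) (.const (.atom 0)))
          (.comp .fst (.comp .snd .snd)))))))

/-- A time bound for `productProg` on tables of length at most `m` with numbers of at most `B`
bits. -/
def productCost (m B : ℕ) : ℕ :=
  2 * (m * (100 * (B + 1) ^ 2 + 180)) + 200 * (B + 1) ^ 3 + 120

theorem runs_productProg_nil {x : SExpr} (m B : ℕ) (b : Prog) :
    Runs b productProg (.cons x (ofList [])) (ofNat 1) (productCost m B) :=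
  (Runs.ite_true (Runs.comp .snd .isAtom_atom) atom_one_ne_zero .const).mono
    (by unfold productCost; omega)

theorem runs_productProg_singleton {m B : ℕ} (r : Fin n) (l : List (Fin n × ℕ))
    (hm : l.length ≤ m) (hB : (sumOn [r] l).size ≤ B) (b : Prog) :
    Runs b productProg (.cons (ofList ([r].map stateCode)) (ofList [tableCode l]))
      (ofNat (sumOn [r] l)) (productCost m B) := by
  refine (Runs.ite_false (Runs.comp .snd .isAtom_cons) (Runs.ite_true
    (Runs.comp (Runs.comp .snd .snd) .isAtom_atom) atom_one_ne_zero
    (Runs.comp (Runs.pair (Runs.pair (Runs.comp .fst .fst) .const) (Runs.comp .snd .fst))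
      (runs_sumProg [r] l hB b)))).mono ?_
  have := Nat.mul_le_mul_right (100 * (B + 1) ^ 2 + 180) hm
  simp only [productCost, List.length_singleton]
  linarith [Nat.zero_le (m * (100 * (B + 1) ^ 2 + 180)), Nat.zero_le ((B + 1) ^ 3)]

theorem runs_productProg_pair {m B : ℕ} (r r' : Fin n) (l l' : List (Fin n × ℕ))
    (hm : l.length ≤ m) (hm' : l'.length ≤ m) (hB : (sumOn [r] l).size ≤ B)
    (hB' : (sumOn [r'] l').size ≤ B) (hp : (sumOn [r] l * sumOn [r'] l').size ≤ B) (b : Prog) :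
    Runs b productProg (.cons (ofList ([r, r'].map stateCode)) (ofList [tableCode l, tableCode l']))
      (ofNat (sumOn [r] l * sumOn [r'] l')) (productCost m B) := by
  refine (Runs.ite_false (Runs.comp .snd .isAtom_cons) (Runs.ite_false
    (Runs.comp (Runs.comp .snd .snd) .isAtom_cons)
    (Runs.comp (Runs.pair
      (Runs.comp (Runs.pair (Runs.pair (Runs.comp .fst .fst) .const) (Runs.comp .snd .fst))
        (runs_sumProg [r] l hB b))
      (Runs.comp (Runs.pair (Runs.pair (Runs.comp (Runs.comp .fst .snd) .fst) .const)
        (Runs.comp (Runs.comp .snd .snd) .fst)) (runs_sumProg [r'] l' hB' b)))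
      (runs_mulProg _ _ hB' hp b)))).mono ?_
  have h1 := Nat.mul_le_mul_right (100 * (B + 1) ^ 2 + 180) hm
  have h2 := Nat.mul_le_mul_right (100 * (B + 1) ^ 2 + 180) hm'
  simp only [productCost, List.length_singleton]
  linarith

end Tables

end SliceCount

/-! ### Correctness and running time of the counting program -/

namespace SliceCount

open SExpr SliceTerm

open Prog (Runs)

namespace TreeAutomaton

open Classical in
/-- The automaton without the transitions whose slices have loops. -/
noncomputable abbrev loopless (A : TreeAutomaton) : TreeAutomaton where
  numStates := A.numStates
  final := A.final
  trans := A.trans.filter fun d => ∀ e ∈ d.2.1.edges, e.src ≠ e.tgt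

variable {A : TreeAutomaton}

theorem mem_trans_loopless {d : List (Fin A.numStates) × Slice × Fin A.numStates} :
    d ∈ A.loopless.trans ↔ d ∈ A.trans ∧ ∀ e ∈ d.2.1.edges, e.src ≠ e.tgt := by
  classical
  exact Finset.mem_filter

theorem card_trans_loopless_le : A.loopless.trans.card ≤ A.trans.card := by
  classical
  exact Finset.card_filter_le _ _

theorem Deterministic.loopless (hA : A.Deterministic) : A.loopless.Deterministic :=
  fun qs S r r' h h' => hA qs S r r' (mem_trans_loopless.1 h).1 (mem_trans_loopless.1 h').1

theorem reaches_loopless {t : SliceTerm} {r : Fin A.numStates} :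
    A.loopless.Reaches t r ↔ A.Reaches t r ∧ ∀ x, t.HasPiece x → x.edge.src ≠ x.edge.tgt := by
  induction t generalizing r with
  | nullary S =>
    refine mem_trans_loopless.trans (and_congr_right fun _ => ?_)
    constructor
    · rintro h ⟨p, e⟩ ⟨S', hS', he⟩
      cases p with
      | nil =>
        cases (get?_nil _).symm.trans hS'
        exact h e he
      | cons a p => simp [get?_nullary_cons] at hS'
    · exact fun h e he => h ⟨[], e⟩ ⟨S, get?_nil _, he⟩
  | unary S t ih =>
    constructor
    · rintro ⟨r₁, h1, h2⟩
      replace h1 := ih.1 h1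
      obtain ⟨h2, h3⟩ := mem_trans_loopless.1 h2
      refine ⟨⟨r₁, h1.1, h2⟩, ?_⟩
      rintro ⟨p, e⟩ ⟨S', hS', he⟩
      cases p with
      | nil =>
        cases (get?_nil _).symm.trans hS'
        exact h3 e he
      | cons a p =>
        simp only [get?_unary_cons] at hS'
        split_ifs at hS'
        exact h1.2 ⟨p, e⟩ ⟨S', hS', he⟩
    · rintro ⟨⟨r₁, h1, h2⟩, h⟩
      refine ⟨r₁, ih.2 ⟨h1, ?_⟩, mem_trans_loopless.2
        ⟨h2, fun e he => h ⟨[], e⟩ ⟨S, get?_nil _, he⟩⟩⟩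
      rintro ⟨p, e⟩ ⟨S', hS', he⟩
      exact h ⟨1 :: p, e⟩ ⟨S', by simpa [get?_unary_cons] using hS', he⟩
  | binary S t₁ t₂ ih₁ ih₂ =>
    constructor
    · rintro ⟨r₁, r₂, h1, h2, h3⟩
      replace h1 := ih₁.1 h1
      replace h2 := ih₂.1 h2
      obtain ⟨h3, h4⟩ := mem_trans_loopless.1 h3
      refine ⟨⟨r₁, r₂, h1.1, h2.1, h3⟩, ?_⟩
      rintro ⟨p, e⟩ ⟨S', hS', he⟩
      cases p with
      | nil =>
        cases (get?_nil _).symm.trans hS'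
        exact h4 e he
      | cons a p =>
        simp only [get?_binary_cons] at hS'
        split_ifs at hS'
        · exact h1.2 ⟨p, e⟩ ⟨S', hS', he⟩
        · exact h2.2 ⟨p, e⟩ ⟨S', hS', he⟩
    · rintro ⟨⟨r₁, r₂, h1, h2, h3⟩, h⟩
      refine ⟨r₁, r₂, ih₁.2 ⟨h1, ?_⟩, ih₂.2 ⟨h2, ?_⟩, mem_trans_loopless.2
        ⟨h3, fun e he => h ⟨[], e⟩ ⟨S, get?_nil _, he⟩⟩⟩
      · rintro ⟨p, e⟩ ⟨S', hS', he⟩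
        exact h ⟨1 :: p, e⟩ ⟨S', by simpa [get?_binary_cons] using hS', he⟩
      · rintro ⟨p, e⟩ ⟨S', hS', he⟩
        exact h ⟨2 :: p, e⟩ ⟨S', by simpa [get?_binary_cons] using hS', he⟩

/-- Digraphs in the graph language have no loops, so accepting runs never use a transition whose
slice has one. -/
theorem language_loopless {k : ℕ} (hk : ∀ H ∈ graphLanguage A.language, H.IsUnionOfPaths k) :
    A.loopless.language = A.language := by
  ext t
  constructor
  · rintro ⟨r, hr, h⟩
    exact ⟨r, hr, (reaches_loopless.1 h).1⟩
  · rintro ⟨r, hr, h⟩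
    refine ⟨r, hr, reaches_loopless.2 ⟨h, fun x hx => ?_⟩⟩
    exact src_ne_tgt_of_isUnionOfPaths (hk _ ⟨t, ⟨r, hr, h⟩,
      ⟨LabeledDigraph.Iso.ofEquiv (Equiv.refl _) (Equiv.refl _) (fun _ => rfl) (fun _ => rfl)
        (fun _ => rfl) (fun _ => rfl)⟩⟩) hx

open Classical in
/-- The table that the program computes for a term: one entry for each transition of the list `lT`
whose slice is a subslice of the root without loops. -/
noncomputable def table (A : TreeAutomaton)
    (lT : List (List (Fin A.numStates) × Slice × Fin A.numStates)) (t : SliceTerm) :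
    List (Fin A.numStates × ℕ) :=
  (lT.filter fun d => decide (d.2.1.IsLooplessSub t.root)).map fun d =>
    (d.2.2, A.loopless.weight t d.1)

theorem length_table_le (lT : List (List (Fin A.numStates) × Slice × Fin A.numStates))
    (t : SliceTerm) : (A.table lT t).length ≤ lT.length := by
  rw [table, List.length_map]
  exact List.length_filter_le _ _

/-- A state may occur in several entries of a table, one for each matching transition. The entries
are never merged; only their sums are meaningful. -/
theorem sumOn_table (hA : A.Deterministic)
    {lT : List (List (Fin A.numStates) × Slice × Fin A.numStates)} (hT : Enumerates lT A.trans)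
    (t : SliceTerm) {s : List (Fin A.numStates)} {s' : Finset (Fin A.numStates)}
    (hs : ∀ r, r ∈ s ↔ r ∈ s') :
    sumOn s (A.table lT t) = ∑ r ∈ s', (A.loopless.runSet t r).card := by
  classical
  refine Eq.trans ?_ (hA.loopless.sum_card_runSet t s').symm
  rw [sumOn, table, List.filter_map, List.map_map,
    List.filter_filter, ← List.sum_toFinset _ (hT.1.filter _)]
  refine Finset.sum_congr ?_ fun _ _ => rfl
  ext d
  simp only [List.mem_toFinset, List.mem_filter, hT.2, Finset.mem_filter, Function.comp,
    Bool.and_eq_true, decide_eq_true_eq, hs]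
  unfold Slice.IsLooplessSub
  tauto

theorem sumOn_table_le (hA : A.Deterministic)
    {lT : List (List (Fin A.numStates) × Slice × Fin A.numStates)} (hT : Enumerates lT A.trans)
    (t : SliceTerm) (s : List (Fin A.numStates)) :
    sumOn s (A.table lT t) ≤ 2 ^ (lT.length * t.size) := by
  classical
  rw [sumOn_table hA hT t (s' := s.toFinset) (by simp), pow_mul, hT.length_eq]
  calc _ ≤ ∑ r, (A.loopless.runSet t r).card :=
        Finset.sum_le_sum_of_subset (Finset.subset_univ _)
    _ ≤ A.loopless.trans.card ^ t.size := hA.loopless.total_le t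
    _ ≤ _ := Nat.pow_le_pow_left (card_trans_loopless_le.trans Nat.lt_two_pow_self.le) _

end TreeAutomaton

open TreeAutomaton

/-- On input `((s, l), d)`, where `s` is the slice at the root, `l` the list of the tables of the
subterms and `d` the list of the transitions, the table of the term. -/
def tableProg : Prog :=
  foldProg (.const (.atom 0))
    (.ite (.comp matchProg (.pair (.comp .fst .fst)
        (.comp .fst (.comp .snd (.comp .fst (.comp .fst .snd))))))
      (.pair (.pair (.comp .snd (.comp .snd (.comp .fst (.comp .fst .snd))))
          (.comp productProg (.pair (.comp .fst (.comp .fst (.comp .fst .snd)))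
            (.comp .snd .fst))))
        (.comp .snd .snd))
      (.comp .snd .snd))

/-- `X` is the cost of comparing slices and `Y` that of a product. The product is needed only for
matching transitions, where the number of states equals the number of tables in `x`. -/
theorem runs_tableProg {A : TreeAutomaton}
    {l : List (SExpr × List (Fin A.numStates) × Slice × Fin A.numStates)}
    (hl : ∀ a ∈ l, TransitionPresents a.1 a.2) {t : SliceTerm} {d x : SExpr}
    (hd : Slice.Presents d t.root) {X Y : ℕ}
    (hX : ∀ a ∈ l, a.2.2.1.numNonloops * (t.root.numNonloops * 400 + 80) ≤ X)
    (hY : ∀ a ∈ l, a.2.2.1.IsLooplessSub t.root → ∀ b,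
      Runs b productProg (.cons (ofList (a.2.1.map stateCode)) x)
        (ofNat (A.loopless.weight t a.2.1)) Y) (b : Prog) :
    Runs b tableProg (.cons (.cons d x) (ofList (l.map Prod.fst)))
      (tableCode (A.table (l.map Prod.snd) t)) (l.length * (X + Y + 500) + 30) := by
  classical
  refine (runs_foldProg (Ns := X + Y + 480) (fun l => tableCode (A.table (l.map Prod.snd) t)) l
    (fun b => Runs.const.of_eq (by simp [table, tableCode, ofList]) le_rfl) ?_ b).mono
    (by linarith)
  rintro ⟨a, τ⟩ l' hl' b
  have hmem : (a, τ) ∈ l := hl'.subset (by simp)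
  obtain ⟨d', hd', ha⟩ := hl _ hmem
  have hX := hX _ hmem
  have hY := hY _ hmem
  simp only at hd' ha hX hY
  subst ha
  refine (Runs.ite (v := decide (τ.2.1.IsLooplessSub t.root))
    (Runs.comp (Runs.pair (Runs.comp .fst .fst)
      (Runs.comp (Runs.comp (Runs.comp (Runs.comp .snd .fst) .fst) .snd) .fst))
      (runs_matchProg hd hd' (by simp) b))
    (n := Y + 40) (fun h => ?_) (fun h => ?_)).mono (by omega)
  · refine (Runs.pair (Runs.pair
      (Runs.comp (Runs.comp (Runs.comp (Runs.comp .snd .fst) .fst) .snd) .snd)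
      (Runs.comp (Runs.pair (Runs.comp (Runs.comp (Runs.comp .snd .fst) .fst) .fst)
        (Runs.comp .fst .snd)) (hY (of_decide_eq_true h) b))) (Runs.comp .snd .snd)).of_eq
      ?_ (by omega)
    simp only [tableCode, table, List.map_cons, List.filter_cons, h, if_true, ofList, entryCode]
  · refine (Runs.comp .snd .snd).of_eq ?_ (by omega)
    simp only [table, List.map_cons, List.filter_cons, h]
    simp

def termBody : Prog :=
  .comp tableProg (.pair (.pair (.comp .fst .snd)
    (.ite (.comp .isAtom (.comp .snd .snd)) (.const (.atom 0))
      (.pair (.comp .call (.pair .fst (.comp .fst (.comp .snd .snd))))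
        (.ite (.comp .isAtom (.comp .snd (.comp .snd .snd))) (.const (.atom 0))
          (.pair (.comp .call (.pair .fst (.comp .fst (.comp .snd (.comp .snd .snd)))))
            (.const (.atom 0))))))) .fst)

/-- On input the list of the transitions and a term, the table of the term. -/
def termProg : Prog := .fix termBody

theorem runs_termBody {A : TreeAutomaton} {Δ : Set Slice} (hA : A.Deterministic)
    (hAr : ∀ d ∈ A.trans, d.1.length = d.2.1.arity)
    {l : List (SExpr × List (Fin A.numStates) × Slice × Fin A.numStates)}
    (hl : ∀ a ∈ l, TransitionPresents a.1 a.2) (hlT : Enumerates (l.map Prod.snd) A.trans)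
    {X B : ℕ} (hX : ∀ S ∈ Δ, ∀ a ∈ l, a.2.2.1.numNonloops * (S.numNonloops * 400 + 80) ≤ X)
    (t : SliceTerm) (ht : t.Over Δ) (hB : l.length * t.size < B) {d : SExpr}
    (hd : SliceTerm.Presents d t) :
    Runs termBody termBody (.cons (ofList (l.map Prod.fst)) d)
      (tableCode (A.table (l.map Prod.snd) t))
      (t.size * (l.length * (X + productCost l.length B + 500) + 150)) := by
  set K := l.length * (X + productCost l.length B + 500) with hK
  have hlen : ∀ t, (A.table (l.map Prod.snd) t).length ≤ l.length := fun t => by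
    simpa using length_table_le (l.map Prod.snd) t
  -- The inequality `k < B` is strict because `2 ^ k` itself has `k + 1` bits.
  have hpow : ∀ {m k : ℕ}, m ≤ 2 ^ k → k < B → m.size ≤ B := fun {m k} h h' =>
    Nat.size_le.2 (h.trans_lt (Nat.pow_lt_pow_right (by norm_num) h'))
  have hsum : ∀ t r, sumOn [r] (A.table (l.map Prod.snd) t) = (A.loopless.runSet t r).card := by
    intro t r
    rw [sumOn_table hA hlT t (s' := {r}) (by simp)]
    exact Finset.sum_singleton _ _
  have hle : ∀ t r, sumOn [r] (A.table (l.map Prod.snd) t) ≤ 2 ^ (l.length * t.size) := by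
    intro t r
    simpa using sumOn_table_le hA hlT t [r]
  have harity : ∀ a ∈ l, ∀ S, a.2.2.1.IsLooplessSub S → a.2.1.length = S.arity := by
    intro a ha S hS
    rw [hAr _ ((hlT.2 _).1 (List.mem_map_of_mem ha)), hS.2.1]
  induction t generalizing d with
  | nullary S =>
    obtain ⟨s, hs, rfl⟩ := hd
    refine (Runs.comp (Runs.pair (Runs.pair (Runs.comp .snd .fst)
      (Runs.ite_true (Runs.comp (Runs.comp .snd .snd) .isAtom_atom) atom_one_ne_zero .const)) .fst)
      (runs_tableProg (t := nullary S) hl hs (hX S ht.1) (Y := productCost l.length B)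
        (fun a ha hS b => ?_) _)).mono ?_
    · have h := harity a ha S hS
      rw [ht.2, List.length_eq_zero_iff] at h
      rw [h]
      exact runs_productProg_nil _ _ _
    · rw [size_nullary]
      omega
  | unary S t ih =>
    obtain ⟨s, d₁, hs, hd₁, rfl⟩ := hd
    rw [size_unary] at hB ⊢
    have hB₁ : l.length * t.size < B := (Nat.mul_le_mul_left _ (Nat.le_succ _)).trans_lt hB
    refine (Runs.comp (Runs.pair (Runs.pair (Runs.comp .snd .fst)
      (Runs.ite_false (Runs.comp (Runs.comp .snd .snd) .isAtom_cons)
        (Runs.pair (Runs.comp (Runs.pair .fst (Runs.comp (Runs.comp .snd .snd) .fst))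
            (Runs.call (ih ht.2.2 hB₁ hd₁)))
          (Runs.ite_true (Runs.comp (Runs.comp (Runs.comp .snd .snd) .snd) .isAtom_atom)
            atom_one_ne_zero .const)))) .fst)
      (runs_tableProg (t := unary S t) hl hs (hX S ht.1) (Y := productCost l.length B)
        (fun a ha hS b => ?_) _)).mono ?_
    · have h := harity a ha S hS
      rw [ht.2.1, List.length_eq_one_iff] at h
      obtain ⟨r, hr⟩ := h
      rw [hr, show A.loopless.weight (unary S t) [r] = _ from (hsum t r).symm]
      exact runs_productProg_singleton r _ (hlen t) (hpow (hle t r) hB₁) b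
    · rw [Nat.add_one_mul]
      omega
  | binary S t₁ t₂ ih₁ ih₂ =>
    obtain ⟨s, d₁, d₂, hs, hd₁, hd₂, rfl⟩ := hd
    rw [size_binary] at hB ⊢
    have hB₁ : l.length * t₁.size < B := (Nat.mul_le_mul_left _ (by omega)).trans_lt hB
    have hB₂ : l.length * t₂.size < B := (Nat.mul_le_mul_left _ (by omega)).trans_lt hB
    -- The exponents of the bounds for the two children add up in the product.
    have hB₃ : l.length * t₁.size + l.length * t₂.size < B := by
      rw [← Nat.mul_add]
      exact (Nat.mul_le_mul_left _ (by omega)).trans_lt hB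
    refine (Runs.comp (Runs.pair (Runs.pair (Runs.comp .snd .fst)
      (Runs.ite_false (Runs.comp (Runs.comp .snd .snd) .isAtom_cons)
        (Runs.pair (Runs.comp (Runs.pair .fst (Runs.comp (Runs.comp .snd .snd) .fst))
            (Runs.call (ih₁ ht.2.2.1 hB₁ hd₁)))
          (Runs.ite_false (Runs.comp (Runs.comp (Runs.comp .snd .snd) .snd) .isAtom_cons)
            (Runs.pair (Runs.comp (Runs.pair .fst
                (Runs.comp (Runs.comp (Runs.comp .snd .snd) .snd) .fst))
              (Runs.call (ih₂ ht.2.2.2 hB₂ hd₂))) .const))))) .fst)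
      (runs_tableProg (t := binary S t₁ t₂) hl hs (hX S ht.1) (Y := productCost l.length B)
        (fun a ha hS b => ?_) _)).mono ?_
    · have h := harity a ha S hS
      rw [ht.2.1, List.length_eq_two] at h
      obtain ⟨r₁, r₂, hr⟩ := h
      rw [hr, show A.loopless.weight (binary S t₁ t₂) [r₁, r₂] = _ from
        congrArg₂ (· * ·) (hsum t₁ r₁).symm (hsum t₂ r₂).symm]
      refine runs_productProg_pair r₁ r₂ _ _ (hlen t₁) (hlen t₂) (hpow (hle t₁ r₁) hB₁)
        (hpow (hle t₂ r₂) hB₂) (hpow ?_ hB₃) b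
      rw [pow_add]
      exact Nat.mul_le_mul (hle t₁ r₁) (hle t₂ r₂)
    · rw [Nat.add_one_mul, Nat.add_mul]
      omega

/-- On input a term and an automaton, the number of accepted subterms. -/
def countProg : Prog :=
  .comp sumProg (.pair (.comp .fst (.comp .snd .snd))
    (.comp termProg (.pair (.comp .snd (.comp .snd .snd)) .fst)))

theorem runs_countProg {A : TreeAutomaton} {Δ : Set Slice} (hA : A.Deterministic)
    (hAr : ∀ d ∈ A.trans, d.1.length = d.2.1.arity) {X : ℕ}
    (hX : ∀ S ∈ Δ, ∀ d ∈ A.trans, d.2.1.numNonloops * (S.numNonloops * 400 + 80) ≤ X)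
    {t : SliceTerm} (ht : t.Over Δ) {dT dA : SExpr} (hdT : SliceTerm.Presents dT t)
    (hdA : TreeAutomaton.Presents dA A) {B : ℕ} (hB : A.trans.card * t.size < B) (b : Prog) :
    Runs b countProg (.cons dT dA) (ofNat (∑ r ∈ A.final, (A.loopless.runSet t r).card))
      (t.size * (A.trans.card * (X + productCost A.trans.card B + 500) + 150) +
        A.trans.card * (A.numStates * 80 + 100 * (B + 1) ^ 2 + 100) + 60) := by
  obtain ⟨lF, lT, ds, hF, hT, hds, rfl⟩ := hdA
  -- Each transition is paired with its own presentation, because the edges of its slice may be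
  -- listed in any order and no encoding function exists.
  obtain ⟨l, hl, rfl, rfl⟩ : ∃ l : List (SExpr × List (Fin A.numStates) × Slice × Fin A.numStates),
      (∀ a ∈ l, TransitionPresents a.1 a.2) ∧ l.map Prod.fst = ds ∧ l.map Prod.snd = lT := by
    clear hT
    induction hds with
    | nil => exact ⟨[], by simp⟩
    | cons h _ ih =>
      obtain ⟨l, h1, h2, h3⟩ := ih
      exact ⟨(_, _) :: l, List.forall_mem_cons.2 ⟨h, h1⟩, by simp [h2], by simp [h3]⟩
  have hlen : l.length = A.trans.card := by rw [← hT.length_eq, List.length_map]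
  have hterm := runs_termBody hA hAr hl hT (X := X) (B := B)
    (fun S hS a ha => hX S hS _ ((hT.2 _).1 (List.mem_map_of_mem ha))) t ht (hlen ▸ hB) hdT
  have hsum := sumOn_table hA hT t (s := lF) (s' := A.final) hF.2
  have hsize : (sumOn lF (A.table (l.map Prod.snd) t)).size ≤ B :=
    Nat.size_le.2 ((sumOn_table_le hA hT t lF).trans_lt
      (Nat.pow_lt_pow_right (by norm_num) (by rwa [List.length_map, hlen])))
  refine (Runs.comp (Runs.pair (Runs.comp (Runs.comp .snd .snd) .fst)
    (Runs.comp (Runs.pair (Runs.comp (Runs.comp .snd .snd) .snd) .fst) (Runs.fix hterm)))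
    (runs_sumProg lF _ hsize b)).of_eq (by rw [hsum]) ?_
  have h1 : (A.table (l.map Prod.snd) t).length ≤ A.trans.card := by
    rw [← hlen]
    simpa using length_table_le (l.map Prod.snd) t
  have h2 : lF.length ≤ A.numStates := by
    rw [hF.length_eq]
    simpa using Finset.card_le_univ A.final
  have h3 := Nat.mul_le_mul h1 (Nat.add_le_add_right
    (Nat.add_le_add_right (Nat.mul_le_mul_right 80 h2) (100 * (B + 1) ^ 2)) 100)
  rw [hlen]
  omega

end SliceCount

/-! ### The polynomial time bound -/

namespace SliceCount

/-- With a single center, an edge that is not a loop has an endpoint in a frontier, and a frontier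
vertex lies on one edge only. There are three frontiers, with at most `c` vertices each. -/
theorem Slice.numNonloops_le {S : Slice} {c : ℕ} (ha : S.arity ≤ 2)
    (hc : ∀ j, (S.frontier j).card ≤ c) : S.numNonloops ≤ 3 * c := by
  have hex : ∀ e, e ∈ S.edges.filter (fun e => e.src ≠ e.tgt) →
      ∃ v : (_ : ℕ) × ℕ, e.Incident (.frontier v.1 v.2) := by
    intro e he
    have hne := (Finset.mem_filter.1 he).2
    cases hs : e.src with
    | frontier j i => exact ⟨⟨j, i⟩, Or.inl hs⟩
    | center =>
      cases ht : e.tgt with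
      | frontier j i => exact ⟨⟨j, i⟩, Or.inr ht⟩
      | center => exact absurd (hs.trans ht.symm) hne
  choose! f hf using hex
  have hcard : ((Finset.range 3).sigma fun j => S.frontier j).card ≤ 3 * c := by
    rw [Finset.card_sigma]
    simpa using Finset.sum_le_card_nsmul (Finset.range 3) (fun j => (S.frontier j).card) c
      fun j _ => hc j
  refine le_trans (Finset.card_le_card_of_injOn f ?_ ?_) hcard
  · intro e he
    have hm := (Finset.mem_filter.1 he).1
    have hj := (S.frontier_of_incident e hm _ _ (hf e he)).1
    exact Finset.mem_coe.2 (Finset.mem_sigma.2 ⟨Finset.mem_range.2 (by omega),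
      Slice.mem_frontier.2 ⟨e, hm, hf e he⟩⟩)
  · intro e he e' he' h
    have h' := hf e' he'
    rw [← h] at h'
    exact S.unique_edge e (Finset.mem_filter.1 he).1 e' (Finset.mem_filter.1 he').1 _ _
      (hf e he) h'

theorem SliceTerm.size_pos (t : SliceTerm) : 0 < t.size := by
  cases t <;> simp [size_nullary, size_unary, size_binary]

/-- The time bound of `countProg` is polynomial. -/
theorem countCost_le {n m s X B a : ℕ} (hn : 0 < n) (ha : m + s + 1 ≤ a) (hB : B = m * n + 1) :
    n * (m * (X + productCost m B + 500) + 150) + m * (s * 80 + 100 * (B + 1) ^ 2 + 100) + 60 ≤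
      4200 * (a * n) ^ 5 * (X + 1) := by
  -- All parameters except `X` are compared with powers of `w`: `m`, `s` and `n` are at most `w`,
  -- and `B + 1` is at most `2 * w`.
  obtain ⟨w, hw⟩ : ∃ w, w = a * n := ⟨_, rfl⟩
  have ha1 : 1 ≤ a := by omega
  have hnw : n ≤ w := by rw [hw]; exact Nat.le_mul_of_pos_left n ha1
  have haw : a ≤ w := by rw [hw]; exact Nat.le_mul_of_pos_right a hn
  have hw1 : 1 ≤ w := ha1.trans haw
  have hBw : B + 1 ≤ 2 * w := by
    have : (m + 1) * n ≤ a * n := Nat.mul_le_mul_right n (by omega)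
    rw [hB, hw]
    nlinarith
  have hmw : m ≤ w := by omega
  have hsw : s ≤ w := by omega
  have h2 : (B + 1) ^ 2 ≤ 4 * w ^ 2 := (Nat.pow_le_pow_left hBw 2).trans_eq (by ring)
  have h3 : (B + 1) ^ 3 ≤ 8 * w ^ 3 := (Nat.pow_le_pow_left hBw 3).trans_eq (by ring)
  have p13 : w ≤ w ^ 3 := by simpa using Nat.pow_le_pow_right hw1 (show 1 ≤ 3 by norm_num)
  have p03 : 1 ≤ w ^ 3 := Nat.one_le_pow _ _ hw1
  have p12 : w ≤ w ^ 2 := by simpa using Nat.pow_le_pow_right hw1 (show 1 ≤ 2 by norm_num)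
  have p02 : 1 ≤ w ^ 2 := Nat.one_le_pow _ _ hw1
  have p35 : w ^ 3 ≤ w ^ 5 := Nat.pow_le_pow_right hw1 (by norm_num)
  have p25 : w ^ 2 ≤ w ^ 5 := Nat.pow_le_pow_right hw1 (by norm_num)
  have hprod : productCost m B ≤ 2880 * w ^ 3 := by
    have : m * (100 * (B + 1) ^ 2 + 180) ≤ w * (100 * (4 * w ^ 2) + 180) := by gcongr
    rw [productCost]
    nlinarith
  have hA : n * (m * (X + productCost m B + 500) + 150) ≤
      w * (w * (X + 2880 * w ^ 3 + 500) + 150) := by gcongr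
  have hC : m * (s * 80 + 100 * (B + 1) ^ 2 + 100) ≤ w * (w * 80 + 100 * (4 * w ^ 2) + 100) := by
    gcongr
  have hX : w ^ 2 * X ≤ w ^ 5 * X := Nat.mul_le_mul_right X p25
  rw [← hw]
  nlinarith

end SliceCount

theorem mainTheorem3 :
    ∃ (P : SliceCount.Prog) (C : ℕ),
      ∀ (Γ₁ Γ₂ : Finset ℕ) (q k z : ℕ) (T : SliceCount.SliceTerm) (A : SliceCount.TreeAutomaton),
        k * z ≤ q →
        T.Over (SliceCount.normalizedAlphabet q Γ₁ Γ₂) →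
        T.IsUnitDecomposition →
        T.TreeZigZagLE z →
        A.IsSliceAutomaton (SliceCount.sliceAlphabet (k * z) q Γ₁ Γ₂) →
        A.Deterministic →
        SliceCount.Saturated (SliceCount.sliceAlphabet (k * z) q Γ₁ Γ₂) A.language z →
        (∀ H ∈ SliceCount.graphLanguage A.language, H.IsUnionOfPaths k) →
        ∀ dT dA : SliceCount.SExpr, SliceCount.SliceTerm.Presents dT T →
          SliceCount.TreeAutomaton.Presents dA A →
          P.OutputsWithin (.cons dT dA)
            (.ofNat (Nat.card {H : T.toDigraph.Sub //
              H.toDigraph ∈ SliceCount.graphLanguage A.language}))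
            (C * T.size ^ C * q ^ (C * (k * z)) * (A.size + 1) ^ C) := by
  -- The factor `4200` comes from `countCost_le` and `4000` from `hXq`. The value of `C` is hidden
  -- so that powers with exponent `C` are not evaluated.
  obtain ⟨C, hC⟩ : ∃ C : ℕ, C = 4200 * 4000 := ⟨_, rfl⟩
  refine ⟨SliceCount.countProg, C, ?_⟩
  intro Γ₁ Γ₂ q k z T A hkz hT hTu hTz hA hdet hsat hk dT dA hdT hdA
  have hcard : Nat.card {H : T.toDigraph.Sub //
      H.toDigraph ∈ SliceCount.graphLanguage A.language} =
        ∑ r ∈ A.final, (A.loopless.runSet T r).card := by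
    rw [SliceCount.card_sub_eq_card_subterm hT hTu hTz hA.2 hsat hk,
      ← SliceCount.TreeAutomaton.language_loopless hk]
    exact hdet.loopless.card_subterms T
  rw [hcard]
  have hX : ∀ S ∈ SliceCount.normalizedAlphabet q Γ₁ Γ₂, ∀ d ∈ A.trans,
      d.2.1.numNonloops * (S.numNonloops * 400 + 80) ≤ 3 * (k * z) * (3 * q * 400 + 80) := by
    intro S hS d hd
    have h1 := SliceCount.Slice.numNonloops_le hS.1.1 hS.1.2.1
    have h2 := SliceCount.Slice.numNonloops_le (hA.1 d hd).1.1 (hA.1 d hd).1.2.1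
    gcongr
  have hrun := SliceCount.runs_countProg hdet (fun d hd => (hA.1 d hd).2) hX hT hdT hdA
    (Nat.lt_succ_self _) SliceCount.countProg
  refine hrun.mono ((SliceCount.countCost_le (a := A.size + 1) T.size_pos
    (by rw [SliceCount.TreeAutomaton.size]; omega) rfl).trans ?_)
  have hT1 := T.size_pos
  -- If `k * z = 0`, then `q` may be `0`, and the power is `1` also in that case. Otherwise `1 ≤ k *
  -- z ≤ q`, and the left side is at most `3841 * q ^ 2`.
  have hXq : 3 * (k * z) * (3 * q * 400 + 80) + 1 ≤ 4000 * q ^ (2 * (k * z)) := by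
    rcases Nat.eq_zero_or_pos (k * z) with h | h
    · simp [h]
    · have hq : 1 ≤ q := h.trans_le hkz
      have h2 : q ^ 2 ≤ q ^ (2 * (k * z)) := Nat.pow_le_pow_right hq (by omega)
      have h3 : 3 * (k * z) * (3 * q * 400 + 80) ≤ 3 * q * (3 * q * 400 + 80) := by gcongr
      nlinarith
  have hq : q ^ (2 * (k * z)) ≤ q ^ (C * (k * z)) := by
    rcases Nat.eq_zero_or_pos (k * z) with h | h
    · simp [h]
    · exact Nat.pow_le_pow_right (h.trans_le hkz) (Nat.mul_le_mul_right _ (by omega))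
  have hn : T.size ^ 5 ≤ T.size ^ C := Nat.pow_le_pow_right hT1 (by omega)
  have ha : (A.size + 1) ^ 5 ≤ (A.size + 1) ^ C :=
    Nat.pow_le_pow_right (Nat.succ_pos _) (by omega)
  calc _ ≤ 4200 * ((A.size + 1) * T.size) ^ 5 * (4000 * q ^ (2 * (k * z))) :=
        Nat.mul_le_mul_left _ hXq
    _ = C * T.size ^ 5 * q ^ (2 * (k * z)) * (A.size + 1) ^ 5 := by rw [hC]; ring
    _ ≤ _ := by gcongr
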